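/- Let $d\ge 1$. Call $A\subset\mathbb R^d$ a rare set, $A\in\mathscr R$, if $A$ is open, increasing ($\mathbf x\in A$, $\mathbf y\in[0,\infty)^d$ imply $\mathbf x+\mathbf y\in A$), $A^c$ is convex, and $\mathbf 0\notin\overline A$. For $A\in\mathscr R$ and a nonnegative random vector $\mathbf Z$ put $Z_A=\sup\{u:\mathbf Z\in uA\}$ (with $\sup\emptyset=0$). A distribution $G$ on $[0,\infty)$ with tail $\overline G=1-G$ is in the class $\mathcal C$ if $\overline G(x)>0$ for all $x$ and $\lim_{b\uparrow1}\limsup_{x\to\infty}\overline G(bx)/\overline G(x)=1$. A distribution $F$ of a nonnegative random vector $\mathbf X$ is in $\mathcal C_A$ if the distribution $F_A$ of $X_A$ is in $\mathcal C$. Nonnegative random vectors $\mathbf Z^{(1)},\mathbf Z^{(2)},\dots$ are quasi-asymptotically independent on $A$ ($QAI_A$) if for all $i\ne j$ $$\lim_{x\to\infty}\frac{\mathbf P[Z_A^{(i)}>x,\;Z_A^{(j)}>x]}{\mathbf P[Z_A^{(i)}>x]+\mathbf P[Z_A^{(j)}>x]}=0 .$$ Let $\tau_i=\theta_1+\dots+\theta_i$,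 $i\ge1$, with independent, identically distributed nonnegative inter-arrival times $\theta_j$, let $N(t)=\sup\{i\ge 1:\tau_i\le t\}$ ($\sup\emptyset=0$) be the renewal counting process, and assume that the renewal function $\lambda(t)=\mathbf E[N(t)]$ is finite for every $t\ge 0$. Let $\mathbf X^{(1)},\mathbf X^{(2)},\dots$ be random vectors with common distribution $F$ on $[0,\infty)^d$ and let $\{\xi(t),t\ge0\}$ be a real-valued stochastic process such that $\{\mathbf X^{(i)}\}$, $\{N(t)\}$ and $\{\xi(t)\}$ are mutually independent; here $\xi$ is a measurable process and independence of the process $\xi$ means that there is a $\sigma$-algebra $\mathcal G$ of events for which $(t,\omega)\mapsto\xi(t)(\omega)$ is $\mathcal B([0,\infty))\otimes\mathcal G$-measurable and such that $\sigma(\mathbf X^{(i)},i\ge1)$, $\sigma(N(t),t\ge0)$ and $\mathcal G$ are independent. Assume that $\xi$ is bounded away from $-\infty$: for each finite $T\ge 0$ with $\lambda(T)>0$ there is a constant $K_T>0$ with $\mathbf P[\inf_{0\le t\le T}\xi(t)\ge -K_T]=1$. Let $$\mathbf D(T)=\sum_{i=1}^{N(T)}\mathbf X^{(i)}e^{-\xi(\tau_i)}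 .$$ Theorem. Fix $A\in\mathscr R$. If $\{\mathbf X^{(i)}\}$ are $QAI_A$ and $F\in\mathcal C_A$, then for every fixed finite $T\ge0$ with $\lambda(T)>0$ $$\lim_{x\to\infty}\frac{\mathbf P[\mathbf D(T)\in xA]}{\int_{[0,T]}\mathbf P[\mathbf X e^{-\xi(s)}\in xA]\,\lambda(ds)}=1,$$ where $\mathbf X$ has distribution $F$ and is independent of $\xi$, and $\lambda(ds)$ is the measure on $[0,\infty)$ with $\lambda([0,t])=\lambda(t)$. -/

import Mathlib

open Set Filter Topology MeasureTheory ProbabilityTheory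
open scoped NNReal ENNReal Pointwise

namespace RiskModel

noncomputable section

/-! ### Rare sets and multivariate consistent variation -/

/-- The family `𝓡` of rare sets: open, increasing sets with convex complement whose closure does
not contain the origin.  (`IsUpperSet` for the componentwise order is "increasing".) -/
structure IsRareSet {d : ℕ} (A : Set (Fin d → ℝ)) : Prop where
  isOpen : IsOpen A
  increasing : IsUpperSet A
  convex_compl : Convex ℝ Aᶜ
  zero_notMem_closure : (0 : Fin d → ℝ) ∉ closure A

/-- `z_A = sup {u : z ∈ u A}`.  For `A` rare and `z ≥ 0` the set is bounded above; if it is empty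
the value is `0`. -/
def scaleSup {d : ℕ} (A : Set (Fin d → ℝ)) (z : Fin d → ℝ) : ℝ :=
  sSup {u : ℝ | z ∈ u • A}

/-- The class `𝓒` of consistently varying distributions `G` on the line: the tail is everywhere
positive and `lim_{b ↑ 1} limsup_{x → ∞} G(bx, ∞) / G(x, ∞) = 1`. -/
def ConsistentlyVarying (G : Measure ℝ) : Prop :=
  (∀ x : ℝ, 0 < G (Ioi x)) ∧
    Tendsto (fun b : ℝ => limsup (fun x : ℝ => G (Ioi (b * x)) / G (Ioi x)) atTop)
      (𝓝[<] 1) (𝓝 1)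

/-- `F ∈ 𝓒_A`: the law `F_A` of `Z_A`, for `Z` with law `F`, is consistently varying. -/
def ConsistentlyVaryingOn {d : ℕ} (A : Set (Fin d → ℝ)) (F : Measure (Fin d → ℝ)) : Prop :=
  ConsistentlyVarying (F.map (scaleSup A))

/-! ### Quasi-asymptotic independence -/

/-- Quasi-asymptotic independence of a sequence of (nonnegative) random variables. -/
def QAI {Ω : Type*} [MeasurableSpace Ω] (P : Measure Ω) (Z : ℕ → Ω → ℝ) : Prop :=
  ∀ i j : ℕ, i ≠ j →
    Tendsto
      (fun x : ℝ => P.real {ω | x < Z i ω ∧ x < Z j ω} /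
        (P.real {ω | x < Z i ω} + P.real {ω | x < Z j ω}))
      atTop (𝓝 0)

/-- Quasi-asymptotic independence on `A` of a sequence of (nonnegative) random vectors. -/
def QAIOn {Ω : Type*} [MeasurableSpace Ω] (P : Measure Ω) {d : ℕ} (A : Set (Fin d → ℝ))
    (Z : ℕ → Ω → Fin d → ℝ) : Prop :=
  QAI P (fun i ω => scaleSup A (Z i ω))

/-! ### Renewal counting process

Sequences are indexed from `0`: `X i`, `θ i`, `arrivalTime θ i` are the claim vector, the
inter-arrival time and the arrival time with number `i + 1`. -/

/-- Arrival times `τ = θ_1 + ⋯ + θ_{i+1}`. -/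
def arrivalTime {Ω : Type*} (θ : ℕ → Ω → ℝ≥0) (i : ℕ) (ω : Ω) : ℝ≥0 :=
  ∑ j ∈ Finset.range (i + 1), θ j ω

/-- `N(t) = sup {i ≥ 1 : τ_i ≤ t}`, with `sup ∅ = 0`, as an extended natural number. -/
def countingProcess {Ω : Type*} (θ : ℕ → Ω → ℝ≥0) (t : ℝ≥0) (ω : Ω) : ℕ∞ :=
  ⨆ (i : ℕ) (_ : arrivalTime θ i ω ≤ t), ((i + 1 : ℕ) : ℕ∞)

/-- The renewal function `λ(t) = E[N(t)]`. -/
def renewalFunction {Ω : Type*} [MeasurableSpace Ω] (P : Measure Ω) (θ : ℕ → Ω → ℝ≥0)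
    (t : ℝ≥0) : ℝ≥0∞ :=
  ∫⁻ ω, (countingProcess θ t ω : ℝ≥0∞) ∂P

/-- The measure `λ(ds)` on `[0, ∞)`, that is, the measure with distribution function `λ`
(see `renewalMeasure_Iic`). -/
def renewalMeasure {Ω : Type*} [MeasurableSpace Ω] (P : Measure Ω) (θ : ℕ → Ω → ℝ≥0) :
    Measure ℝ≥0 :=
  Measure.sum fun i : ℕ => P.map (arrivalTime θ i)

/-! ### The risk model -/

/-- The discounted aggregate claim vector `D(T) = ∑_{i ≤ N(T)} X^{(i)} e^{-ξ(τ_i)}`.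
When the renewal function is finite, `N(T) = ∞` only on a null event. -/
def aggregateClaims {Ω : Type*} {d : ℕ} (X : ℕ → Ω → Fin d → ℝ) (θ : ℕ → Ω → ℝ≥0)
    (ξ : ℝ≥0 → Ω → ℝ) (T : ℝ≥0) (ω : Ω) : Fin d → ℝ :=
  ∑ i ∈ Finset.range (countingProcess θ T ω).toNat,
    Real.exp (-ξ (arrivalTime θ i ω) ω) • X i ω

/-- Mutual independence of the sequence `X`, the process `N` and the process `ξ`.

The process `ξ` is evaluated at the random times `τ_i`, so it has to be jointly measurable in
`(t, ω)`, and its independence of the rest has to refer to the randomness that drives `ξ` as a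
function of `(t, ω)`, not just to its values at fixed times: `𝒢` is a σ-algebra with respect to
which `ξ` is jointly measurable.  (For a process with right-continuous paths `𝒢` may be taken to
be the σ-algebra generated by the `ξ t`.) -/
def MutuallyIndependent {Ω : Type*} [mΩ : MeasurableSpace Ω] (P : Measure Ω) {d : ℕ}
    (X : ℕ → Ω → Fin d → ℝ) (N : ℝ≥0 → Ω → ℕ∞) (ξ : ℝ≥0 → Ω → ℝ) : Prop :=
  ∃ 𝒢 : MeasurableSpace Ω, 𝒢 ≤ mΩ ∧
    Measurable[(inferInstance : MeasurableSpace ℝ≥0).prod 𝒢] (fun p : ℝ≥0 × Ω => ξ p.1 p.2) ∧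
    iIndep
      ![MeasurableSpace.comap (fun ω i => X i ω) MeasurableSpace.pi,
        MeasurableSpace.comap (fun ω t => N t ω) MeasurableSpace.pi,
        𝒢] P

/-- The multivariate renewal risk model with claim vectors `X` of common law `F`, inter-arrival
times `θ` and logarithmic return process `ξ`. -/
structure IsRenewalRiskModel {Ω : Type*} [MeasurableSpace Ω] (P : Measure Ω) {d : ℕ}
    (F : Measure (Fin d → ℝ)) (X : ℕ → Ω → Fin d → ℝ) (θ : ℕ → Ω → ℝ≥0)
    (ξ : ℝ≥0 → Ω → ℝ) : Prop where
  measurable_claim : ∀ i, Measurable (X i)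
  law_claim : ∀ i, P.map (X i) = F
  nonneg_claim : ∀ᵐ z ∂F, 0 ≤ z
  measurable_interarrival : ∀ i, Measurable (θ i)
  iIndepFun_interarrival : iIndepFun θ P
  identDistrib_interarrival : ∀ i, IdentDistrib (θ i) (θ 0) P P
  renewalFunction_lt_top : ∀ t, renewalFunction P θ t < ∞
  mutuallyIndependent : MutuallyIndependent P X (countingProcess θ) ξ

/-- `ξ` is bounded away from `-∞` on every finite horizon `T` with `λ(T) > 0`:
`P[inf_{0 ≤ t ≤ T} ξ(t) ≥ -K_T] = 1` for a constant `K_T > 0`. -/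
def BoundedAwayFromNegInfty {Ω : Type*} [MeasurableSpace Ω] (P : Measure Ω)
    (θ : ℕ → Ω → ℝ≥0) (ξ : ℝ≥0 → Ω → ℝ) : Prop :=
  ∀ T : ℝ≥0, 0 < renewalFunction P θ T →
    ∃ K : ℝ, 0 < K ∧ ∀ᵐ ω ∂P, ∀ t ≤ T, -K ≤ ξ t ω

/-! ### Checks of the definitions -/

theorem arrivalTime_mono {Ω : Type*} (θ : ℕ → Ω → ℝ≥0) (ω : Ω) :
    Monotone fun i => arrivalTime θ i ω := by
  intro i j hij
  exact Finset.sum_le_sum_of_subset (Finset.range_mono (by omega))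

theorem countingProcess_eq_tsum {Ω : Type*} (θ : ℕ → Ω → ℝ≥0) (t : ℝ≥0) (ω : Ω) :
    (countingProcess θ t ω : ℝ≥0∞) =
      ∑' i : ℕ, {ω | arrivalTime θ i ω ≤ t}.indicator (fun _ => (1 : ℝ≥0∞)) ω := by
  have key : ∀ i : ℕ, ((i + 1 : ℕ) : ℕ∞) ≤ countingProcess θ t ω ↔ arrivalTime θ i ω ≤ t := by
    intro i
    refine ⟨fun h => ?_, fun h => le_iSup₂_of_le i h le_rfl⟩
    by_contra hlt
    have hle : countingProcess θ t ω ≤ (i : ℕ∞) := by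
      refine iSup₂_le fun j hj => ?_
      have : j < i := by
        by_contra hji
        exact hlt ((arrivalTime_mono θ ω (not_lt.mp hji)).trans hj)
      exact_mod_cast this
    have := h.trans hle
    norm_cast at this
    omega
  have hsum : ∀ n : ℕ∞, (n : ℝ≥0∞) =
      ∑' i : ℕ, if ((i + 1 : ℕ) : ℕ∞) ≤ n then (1 : ℝ≥0∞) else 0 := by
    intro n
    induction n with
    | top => simp
    | coe n =>
      rw [tsum_eq_sum (s := Finset.range n)]
      · rw [Finset.sum_congr rfl (g := fun _ => (1 : ℝ≥0∞))]
        · simp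
        · intro i hi
          rw [if_pos]
          have := Finset.mem_range.mp hi
          exact_mod_cast this
      · intro i hi
        rw [if_neg]
        intro h
        norm_cast at h
        exact hi (Finset.mem_range.mpr h)
  rw [hsum]
  refine tsum_congr fun i => ?_
  simp only [key, Set.indicator_apply, Set.mem_ofPred_eq]

/-- `λ(ds)` has distribution function `λ`; in particular `λ(t) = ∑ P[τ_i ≤ t]`. -/
theorem renewalMeasure_Iic {Ω : Type*} [MeasurableSpace Ω] (P : Measure Ω)
    (θ : ℕ → Ω → ℝ≥0) (hθ : ∀ i, Measurable (θ i)) (t : ℝ≥0) :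
    renewalMeasure P θ (Iic t) = renewalFunction P θ t := by
  have hτ : ∀ i, Measurable (arrivalTime θ i) := fun i =>
    Finset.measurable_fun_sum _ fun j _ => hθ j
  have hs : ∀ i, MeasurableSet {ω | arrivalTime θ i ω ≤ t} := fun i =>
    measurableSet_le (hτ i) measurable_const
  simp only [renewalMeasure, renewalFunction, countingProcess_eq_tsum]
  rw [Measure.sum_apply _ measurableSet_Iic, lintegral_tsum]
  · refine tsum_congr fun i => ?_
    rw [lintegral_indicator (hs i), Measure.map_apply (hτ i) measurableSet_Iic]
    simp [Set.preimage]
  · exact fun i => (measurable_const.indicator (hs i)).aemeasurable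

/-- For a rare set `A`, `z ≥ 0` and `x > 0`, one has `z_A > x` iff `z ∈ x A`. -/
theorem lt_scaleSup_iff {d : ℕ} {A : Set (Fin d → ℝ)} (hA : IsRareSet A) {z : Fin d → ℝ}
    (hz : 0 ≤ z) {x : ℝ} (hx : 0 < x) : x < scaleSup A z ↔ z ∈ x • A := by
  have hmono : ∀ u v : ℝ, 0 < v → v ≤ u → z ∈ u • A → z ∈ v • A := by
    intro u v hv hvu h
    rw [mem_smul_set_iff_inv_smul_mem₀ (hv.trans_le hvu).ne'] at h
    rw [mem_smul_set_iff_inv_smul_mem₀ hv.ne']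
    exact hA.increasing (smul_le_smul_of_nonneg_right (inv_anti₀ hv hvu) hz) h
  have hcont : ∀ v : ℝ, v ≠ 0 → ContinuousAt (fun u : ℝ => u⁻¹ • z) v := fun v hv =>
    (continuousAt_inv₀ hv).smul continuousAt_const
  constructor
  · intro h
    have hne : {u : ℝ | z ∈ u • A}.Nonempty := by
      by_contra hemp
      rw [Set.not_nonempty_iff_eq_empty] at hemp
      rw [scaleSup, hemp, Real.sSup_empty] at h
      exact (hx.trans h).false
    obtain ⟨u, hu, hxu⟩ := exists_lt_of_lt_csSup hne h
    exact hmono u x hx hxu.le hu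
  · intro h
    have hbdd : BddAbove {u : ℝ | z ∈ u • A} := by
      by_contra hunb
      rw [not_bddAbove_iff] at hunb
      refine hA.zero_notMem_closure ?_
      have hlim : Tendsto (fun u : ℝ => u⁻¹ • z) atTop (𝓝 (0 : Fin d → ℝ)) := by
        simpa using (tendsto_inv_atTop_zero (𝕜 := ℝ)).smul_const z
      refine mem_closure_of_tendsto hlim ?_
      filter_upwards [eventually_gt_atTop (0 : ℝ)] with v hv
      obtain ⟨u, hu, hvu⟩ := hunb v
      exact (mem_smul_set_iff_inv_smul_mem₀ hv.ne' _ _).mp (hmono u v hv hvu.le hu)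
    rw [mem_smul_set_iff_inv_smul_mem₀ hx.ne'] at h
    have hev := (hcont x hx.ne').eventually (hA.isOpen.mem_nhds h)
    have hev' : ∀ᶠ v in 𝓝[>] x, v⁻¹ • z ∈ A := hev.filter_mono nhdsWithin_le_nhds
    obtain ⟨v, hvA, hxv⟩ := (hev'.and self_mem_nhdsWithin).exists
    have hxv' : x < v := hxv
    refine hxv'.trans_le (le_csSup hbdd ?_)
    exact (mem_smul_set_iff_inv_smul_mem₀ (hx.trans hxv').ne' _ _).mpr hvA

theorem scaleSup_nonneg {d : ℕ} {A : Set (Fin d → ℝ)} (hA : IsRareSet A) {z : Fin d → ℝ}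
    (hz : 0 ≤ z) : 0 ≤ scaleSup A z := by
  refine Real.sSup_nonneg fun u hu => ?_
  by_contra hneg
  have hu0 : u < 0 := not_le.mp hneg
  have hmem := (mem_smul_set_iff_inv_smul_mem₀ hu0.ne _ _).mp hu
  have hle : u⁻¹ • z ≤ 0 := smul_nonpos_of_nonpos_of_nonneg (inv_lt_zero.mpr hu0).le hz
  exact hA.zero_notMem_closure (subset_closure (hA.increasing hle hmem))

/-- `z ↦ z_A` is measurable up to null sets of a law on the nonnegative quadrant. -/
theorem aemeasurable_scaleSup {d : ℕ} {A : Set (Fin d → ℝ)} (hA : IsRareSet A)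
    {F : Measure (Fin d → ℝ)} (hF : ∀ᵐ z ∂F, 0 ≤ z) : AEMeasurable (scaleSup A) F := by
  have hsup : Measurable fun z : Fin d → ℝ => z ⊔ 0 :=
    measurable_pi_lambda _ fun i => (measurable_pi_apply i).sup_const 0
  refine ⟨fun z => scaleSup A (z ⊔ 0), ?_, ?_⟩
  · have hpos : ∀ x : ℝ, 0 < x → MeasurableSet {z : Fin d → ℝ | x < scaleSup A (z ⊔ 0)} := by
      intro x hx
      have : {z : Fin d → ℝ | x < scaleSup A (z ⊔ 0)} = (fun z => z ⊔ 0) ⁻¹' (x • A) := by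
        ext z
        exact lt_scaleSup_iff hA le_sup_right hx
      rw [this]
      exact hsup (hA.isOpen.smul₀ hx.ne').measurableSet
    refine measurable_of_Ioi fun x => ?_
    rcases lt_trichotomy x 0 with hx | hx | hx
    · convert MeasurableSet.univ
      ext z
      simpa using hx.trans_le (scaleSup_nonneg hA (le_sup_right : (0 : Fin d → ℝ) ≤ z ⊔ 0))
    · have : (fun z : Fin d → ℝ => scaleSup A (z ⊔ 0)) ⁻¹' Ioi x =
          ⋃ n : ℕ, {z : Fin d → ℝ | 1 / ((n : ℝ) + 1) < scaleSup A (z ⊔ 0)} := by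
        ext z
        simp only [hx, mem_preimage, mem_Ioi, mem_iUnion]
        exact ⟨fun h => exists_nat_one_div_lt h,
          fun ⟨n, hn⟩ => lt_trans Nat.one_div_pos_of_nat hn⟩
      rw [this]
      exact MeasurableSet.iUnion fun n => hpos _ Nat.one_div_pos_of_nat
    · exact hpos x hx
  · filter_upwards [hF] with z hz
    rw [sup_eq_left.mpr hz]

/-- The tail of `F_A`: `F_A(x, ∞) = F(x A)` for `x > 0`. -/
theorem map_scaleSup_Ioi {d : ℕ} {A : Set (Fin d → ℝ)} (hA : IsRareSet A)
    {F : Measure (Fin d → ℝ)} (hF : ∀ᵐ z ∂F, 0 ≤ z) {x : ℝ} (hx : 0 < x) :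
    F.map (scaleSup A) (Ioi x) = F (x • A) := by
  rw [Measure.map_apply_of_aemeasurable (aemeasurable_scaleSup hA hF) measurableSet_Ioi]
  refine measure_congr ?_
  filter_upwards [hF] with z hz
  exact propext (lt_scaleSup_iff hA hz hx)

end

end RiskModel

namespace RiskModel

/-! ### Tails of consistently varying distributions -/

/-! The problem becomes one-dimensional through `Y i = scaleSup A (X i)` and the weights `W i =
e^{-ξ(τ_i)}` for `τ_i ≤ T`, zero afterwards. Since `A` is increasing and claims are nonnegative,
`D(T)` lies in `x • A` as soon as one summand does, i.e. some `W i * Y i > x`. Since `Aᶜ` is convex,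
`scaleSup A` is subadditive (`scaleSup_add_le`), so `D(T) ∈ x • A` forces `∑ W i * Y i > x`. By
conditioning on the arrival times, the denominator equals `H(x) = ∑' i, P[W i * Y i > x]`. It
remains to squeeze: `P[max > x]` and `P[sum > x]` are both asymptotic to `H(x)`.

Upper bound (`eventually_sum_le_add`): a large sum comes from many claims, from one term above `b *
x` with `b` close to 1, or from two large claims. The first case is negligible because a Potter
bound loses only a power of the number of claims, and `N(T)` has all moments (Chernoff). The second
costs a factor `1 + ε` by consistent variation, uniformly in the weights since they are bounded. The
third is negligible by quasi-asymptotic independence.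

Lower bound (`eventually_tsum_le_add`): Bonferroni for finitely many indices, plus a tail controlled
by `∑ P[τ_i ≤ T] = λ(T) < ∞`.

All errors are small multiples of the tail `G(x)` of `Y`, and `G(x) ≤ M * H(x)`
(`exists_tail_le_tsum`), so they are relative errors. The weights may depend arbitrarily on each
other and on `N`; only `W i` against `Y i` and `N` against the whole sequence `Y` need independence.
-/

theorem ConsistentlyVarying.exists_tail_mul_le {G : Measure ℝ} [IsFiniteMeasure G]
    (hG : ConsistentlyVarying G) {ε : ℝ≥0∞} (hε : 0 < ε) :
    ∃ b : ℝ, 0 < b ∧ b < 1 ∧ ∃ x₀ : ℝ, 0 < x₀ ∧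
      ∀ x, x₀ ≤ x → G (Ioi (b * x)) ≤ (1 + ε) * G (Ioi x) := by
  have h1 : ∀ᶠ b : ℝ in 𝓝[<] 1,
      limsup (fun x : ℝ => G (Ioi (b * x)) / G (Ioi x)) atTop < 1 + ε :=
    hG.2.eventually_lt_const (ENNReal.lt_add_right ENNReal.one_ne_top hε.ne')
  have h2 : ∀ᶠ b : ℝ in 𝓝[<] 1, 0 < b ∧ b < 1 := Ioo_mem_nhdsLT zero_lt_one
  obtain ⟨b, hb, hb0, hb1⟩ := (h1.and h2).exists
  have h3 := eventually_lt_of_limsup_lt hb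
  obtain ⟨x₀, hx₀⟩ := eventually_atTop.mp h3
  refine ⟨b, hb0, hb1, max x₀ 1, by positivity, fun x hx => ?_⟩
  exact (ENNReal.div_le_iff (hG.1 x).ne' (measure_ne_top _ _)).mp
    (hx₀ x ((le_max_left _ _).trans hx)).le

/-- A Potter-type bound for the tail. -/
theorem ConsistentlyVarying.exists_tail_div_nat_le {G : Measure ℝ} [IsProbabilityMeasure G]
    (hG : ConsistentlyVarying G) :
    ∃ M : ℝ≥0∞, M ≠ ∞ ∧ ∃ p : ℕ, ∀ x : ℝ, 0 ≤ x → ∀ n : ℕ, 1 ≤ n →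
      G (Ioi (x / n)) ≤ M * (n : ℝ≥0∞) ^ p * G (Ioi x) := by
  obtain ⟨b, hb0, hb1, x₀, hx₀, hb⟩ := hG.exists_tail_mul_le one_pos
  have hanti : ∀ {x y : ℝ}, x ≤ y → G (Ioi y) ≤ G (Ioi x) := fun h =>
    measure_mono (Ioi_subset_Ioi h)
  -- The doubling bound holds only beyond `x₀`. Capping tails at `G (Ioi x₀)` makes it valid for
  -- every `y`, so it can be iterated.
  have hstep : ∀ y : ℝ, min (G (Ioi (b * y))) (G (Ioi x₀)) ≤ 2 * min (G (Ioi y)) (G (Ioi x₀)) := by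
    intro y
    rcases le_total x₀ y with h | h
    · rw [min_eq_left (hanti h)]
      refine (min_le_left _ _).trans ((hb y h).trans_eq ?_)
      norm_num
    · rw [min_eq_right (hanti h)]
      exact (min_le_right _ _).trans (le_mul_of_one_le_left' one_le_two)
  have hiter : ∀ (k : ℕ) (y : ℝ),
      min (G (Ioi (b ^ k * y))) (G (Ioi x₀)) ≤ 2 ^ k * min (G (Ioi y)) (G (Ioi x₀)) := by
    intro k
    induction k with
    | zero => intro y; simp
    | succ k ih =>
      intro y
      calc min (G (Ioi (b ^ (k + 1) * y))) (G (Ioi x₀))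
          = min (G (Ioi (b ^ k * (b * y)))) (G (Ioi x₀)) := by rw [pow_succ, mul_assoc]
        _ ≤ 2 ^ k * min (G (Ioi (b * y))) (G (Ioi x₀)) := ih _
        _ ≤ 2 ^ k * (2 * min (G (Ioi y)) (G (Ioi x₀))) := by gcongr; exact hstep y
        _ = 2 ^ (k + 1) * min (G (Ioi y)) (G (Ioi x₀)) := by rw [pow_succ, mul_assoc]
  have hne : G (Ioi x₀) ≠ 0 := (hG.1 x₀).ne'
  have hall : ∀ (k : ℕ) (y : ℝ), G (Ioi (b ^ k * y)) ≤ (G (Ioi x₀))⁻¹ * 2 ^ k * G (Ioi y) := by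
    intro k y
    -- The cap is removed at the price of a constant: a product of two numbers at most 1 is below
    -- their minimum.
    have h1 : G (Ioi (b ^ k * y)) * G (Ioi x₀) ≤ min (G (Ioi (b ^ k * y))) (G (Ioi x₀)) :=
      le_min (mul_le_of_le_one_right' prob_le_one) (mul_le_of_le_one_left' prob_le_one)
    have h2 : G (Ioi (b ^ k * y)) * G (Ioi x₀) ≤ 2 ^ k * G (Ioi y) :=
      (h1.trans (hiter k y)).trans (by gcongr; exact min_le_left _ _)
    rw [mul_assoc]
    rwa [← ENNReal.div_eq_inv_mul, ENNReal.le_div_iff_mul_le (Or.inl hne)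
      (Or.inl (measure_ne_top _ _))]
  -- With `b ^ q < 1/2` and `n < 2 ^ j ≤ 2 * n`, scaling by `1 / n` takes at most `q * j` steps,
  -- each costing a factor 2; the total `(2 ^ j) ^ q` is polynomial in `n`.
  obtain ⟨q, hq⟩ := exists_pow_lt_of_lt_one (show (0 : ℝ) < 1 / 2 by norm_num) hb1
  refine ⟨(G (Ioi x₀))⁻¹ * 2 ^ q, ENNReal.mul_ne_top (ENNReal.inv_ne_top.mpr hne) (by simp), q,
    fun x hx n hn => ?_⟩
  set j := Nat.log 2 n + 1 with hj
  have hn' : n < 2 ^ j := Nat.lt_pow_succ_log_self one_lt_two n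
  have hn'' : 2 ^ j ≤ 2 * n := by
    rw [hj, pow_succ, mul_comm]
    exact Nat.mul_le_mul_left 2 (Nat.pow_log_le_self 2 (by omega))
  have hle : b ^ (q * j) * x ≤ x / n := by
    have h1 : b ^ (q * j) ≤ (1 / 2) ^ j := by
      rw [pow_mul]; exact pow_le_pow_left₀ (by positivity) hq.le _
    have h2 : ((1 : ℝ) / 2) ^ j ≤ 1 / n := by
      rw [div_pow, one_pow]
      exact one_div_le_one_div_of_le (by positivity) (by exact_mod_cast hn'.le)
    calc b ^ (q * j) * x ≤ (1 / n) * x := by gcongr; exact h1.trans h2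
      _ = x / n := by ring
  refine (hanti hle).trans ((hall _ x).trans ?_)
  gcongr ?_ * _
  rw [mul_assoc]
  gcongr _ * ?_
  calc (2 : ℝ≥0∞) ^ (q * j) = ((2 ^ j : ℕ) : ℝ≥0∞) ^ q := by
        rw [mul_comm, pow_mul]; norm_num
    _ ≤ ((2 * n : ℕ) : ℝ≥0∞) ^ q := by gcongr
    _ = 2 ^ q * (n : ℝ≥0∞) ^ q := by push_cast; rw [mul_pow]

/-- Dominated variation, used below to absorb fixed constants in the argument of the tail. -/
theorem ConsistentlyVarying.exists_tail_mul_le_mul {G : Measure ℝ} [IsProbabilityMeasure G]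
    (hG : ConsistentlyVarying G) {c : ℝ} (hc : 0 < c) :
    ∃ M : ℝ≥0∞, M ≠ ∞ ∧ ∀ x : ℝ, 0 ≤ x → G (Ioi (c * x)) ≤ M * G (Ioi x) := by
  obtain ⟨M, hM, p, h⟩ := hG.exists_tail_div_nat_le
  obtain ⟨n, hn⟩ := exists_nat_gt (1 / c)
  have hn0 : (0 : ℝ) < n := (by positivity : (0 : ℝ) < 1 / c).trans hn
  refine ⟨M * (n : ℝ≥0∞) ^ p, ENNReal.mul_ne_top hM (by simp), fun x hx => ?_⟩
  refine (measure_mono (Ioi_subset_Ioi ?_)).trans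
    (h x hx n (Nat.one_le_iff_ne_zero.mpr fun h0 => by simp [h0] at hn0))
  rw [div_lt_iff₀ hc] at hn
  rw [div_le_iff₀ hn0]
  nlinarith

/-! ### One big jump -/

/-- Some term exceeds the mean `x / m`. If no other term exceeds `(1 - b) * x / m`, the others total
at most `(1 - b) * x`, leaving more than `b * x` for that one. -/
theorem exists_lt_or_exists_pair_lt_of_lt_sum {u : ℕ → ℝ} {m : ℕ}
    {b x : ℝ} (hb0 : 0 < b) (hb1 : b ≤ 1) (hx : 0 < x) (h : x < ∑ i ∈ Finset.range m, u i) :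
    (∃ i ∈ Finset.range m, b * x < u i) ∨
      ∃ i ∈ Finset.range m, ∃ j ∈ Finset.range m, i ≠ j ∧
        (1 - b) * x / m < u i ∧ (1 - b) * x / m < u j := by
  by_contra! hcon
  obtain ⟨h1, h2⟩ := hcon
  have hm : (0 : ℝ) < m := by
    rcases Nat.eq_zero_or_pos m with rfl | hm
    · simp at h; linarith
    · exact_mod_cast hm
  have hsum : ∑ _i ∈ Finset.range m, x / m < ∑ i ∈ Finset.range m, u i := by
    rw [Finset.sum_const, Finset.card_range, nsmul_eq_mul, mul_div_cancel₀ _ hm.ne']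
    exact h
  obtain ⟨i, hi, hxi⟩ := Finset.exists_lt_of_sum_lt hsum
  have hai : (1 - b) * x / m < u i := by
    refine lt_of_le_of_lt ?_ hxi
    gcongr
    nlinarith
  have herase : ∑ j ∈ (Finset.range m).erase i, u j ≤ (1 - b) * x := by
    have hb1' : 0 ≤ (1 - b) * x := mul_nonneg (sub_nonneg.mpr hb1) hx.le
    calc ∑ j ∈ (Finset.range m).erase i, u j
        ≤ ((Finset.range m).erase i).card • ((1 - b) * x / m) :=
          Finset.sum_le_card_nsmul _ _ _ fun j hj =>
            h2 i hi j (Finset.mem_of_mem_erase hj) (Finset.ne_of_mem_erase hj).symm hai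
      _ ≤ (m : ℝ) * ((1 - b) * x / m) := by
          rw [nsmul_eq_mul]
          gcongr
          exact (Finset.card_erase_le).trans (Finset.card_range m).le
      _ = (1 - b) * x := by field_simp
  have := Finset.add_sum_erase _ u hi
  linarith [h1 i hi]

/-! ### Randomly weighted random sums -/

theorem exists_tsum_tail_le {f : ℕ → ℝ≥0∞} (hf : ∑' n, f n ≠ ∞) {δ : ℝ≥0∞} (hδ : 0 < δ) :
    ∃ m : ℕ, ∑' n, (if m ≤ n then f n else 0) ≤ δ := by
  have h := ((ENNReal.tendsto_tsum_compl_atTop_zero hf).comp tendsto_finset_range).eventually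
    (eventually_le_nhds hδ)
  obtain ⟨m, hm⟩ := h.exists
  refine ⟨m, le_trans (le_of_eq ?_) hm⟩
  simp only [Function.comp]
  refine Eq.trans (tsum_congr fun n => ?_) (tsum_subtype {x | x ∉ Finset.range m} f).symm
  simp [Set.indicator_apply]

/-- Bonferroni's inequality, adding one event at a time by inclusion-exclusion for two sets. -/
theorem sum_measure_le_measure_biUnion_add {Ω : Type*} [MeasurableSpace Ω] (P : Measure Ω)
    {E : ℕ → Set Ω} (hE : ∀ i, MeasurableSet (E i)) (m : ℕ) :
    ∑ i ∈ Finset.range m, P (E i) ≤ P (⋃ i ∈ Finset.range m, E i) +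
      ∑ i ∈ Finset.range m, ∑ j ∈ Finset.range i, P (E j ∩ E i) := by
  induction m with
  | zero => simp
  | succ m ih =>
    set U := ⋃ i ∈ Finset.range m, E i with hU
    have hunion : ⋃ i ∈ Finset.range (m + 1), E i = U ∪ E m := by
      rw [Finset.range_add_one, Finset.set_biUnion_insert, union_comm]
    have hinter : P (U ∩ E m) ≤ ∑ j ∈ Finset.range m, P (E j ∩ E m) := by
      rw [hU, iUnion₂_inter]
      exact measure_biUnion_finset_le _ _
    rw [Finset.sum_range_succ, Finset.sum_range_succ, hunion]
    calc ∑ i ∈ Finset.range m, P (E i) + P (E m)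
        ≤ (P U + ∑ i ∈ Finset.range m, ∑ j ∈ Finset.range i, P (E j ∩ E i)) + P (E m) := by
          gcongr
      _ = (P U + P (E m)) + ∑ i ∈ Finset.range m, ∑ j ∈ Finset.range i, P (E j ∩ E i) := by ring
      _ = (P (U ∪ E m) + P (U ∩ E m)) +
            ∑ i ∈ Finset.range m, ∑ j ∈ Finset.range i, P (E j ∩ E i) := by
          rw [measure_union_add_inter _ (hE m)]
      _ ≤ (P (U ∪ E m) + ∑ j ∈ Finset.range m, P (E j ∩ E m)) +
            ∑ i ∈ Finset.range m, ∑ j ∈ Finset.range i, P (E j ∩ E i) := by gcongr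
      _ = _ := by ring

theorem inv_mul_lt_of_lt_mul {C x w y : ℝ} (hC : 0 < C) (hy : 0 ≤ y) (hw : w ≤ C)
    (hxy : x < w * y) : C⁻¹ * x < y := by
  rw [inv_mul_lt_iff₀ hC]
  exact hxy.trans_le (mul_le_mul_of_nonneg_right hw hy)

theorem measure_lt_mul_eq_lintegral {Ω : Type*} [MeasurableSpace Ω] {P : Measure Ω}
    [IsProbabilityMeasure P] {W Y : Ω → ℝ} (hW : Measurable W) (hY : Measurable Y)
    (hWY : IndepFun W Y P) (x : ℝ) :
    P {ω | x < W ω * Y ω} = ∫⁻ w, P.map Y {y | x < w * y} ∂(P.map W) := by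
  have hs : MeasurableSet {p : ℝ × ℝ | x < p.1 * p.2} :=
    measurableSet_lt measurable_const (measurable_fst.mul measurable_snd)
  have h := (indepFun_iff_map_prod_eq_prod_map_map hW.aemeasurable hY.aemeasurable).mp hWY
  have := Measure.isProbabilityMeasure_map (μ := P) hY.aemeasurable
  calc P {ω | x < W ω * Y ω} = P.map (fun ω => (W ω, Y ω)) {p : ℝ × ℝ | x < p.1 * p.2} := by
        rw [Measure.map_apply (hW.prodMk hY) hs]; rfl
    _ = _ := by rw [h, Measure.prod_apply hs]; rfl

/-- Given `W = w > 0` the threshold for `Y` is `x / w ≥ x / C ≥ x₀`, so the tail comparison applies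
uniformly in `w`; for `w = 0` both events are empty. -/
theorem measure_mul_lt_mul_le {Ω : Type*} [MeasurableSpace Ω] {P : Measure Ω}
    [IsProbabilityMeasure P] {W Y : Ω → ℝ} (hW : Measurable W) (hY : Measurable Y)
    (hWY : IndepFun W Y P) {C : ℝ} (hWC : ∀ᵐ ω ∂P, 0 ≤ W ω ∧ W ω ≤ C)
    {b x₀ : ℝ} (hb : 0 < b) (hx₀ : 0 < x₀) {K : ℝ≥0∞} (hK : K ≠ ∞)
    (hbK : ∀ x, x₀ ≤ x → P.map Y (Ioi (b * x)) ≤ K * P.map Y (Ioi x))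
    {x : ℝ} (hx : 0 < x) (hxC : C * x₀ ≤ x) :
    P {ω | b * x < W ω * Y ω} ≤ K * P {ω | x < W ω * Y ω} := by
  rw [measure_lt_mul_eq_lintegral hW hY hWY, measure_lt_mul_eq_lintegral hW hY hWY,
    ← lintegral_const_mul' _ _ hK]
  refine lintegral_mono_ae ?_
  have hae : ∀ᵐ w ∂(P.map W), 0 ≤ w ∧ w ≤ C :=
    (ae_map_iff hW.aemeasurable measurableSet_Icc).mpr hWC
  filter_upwards [hae] with w hw
  rcases hw.1.eq_or_lt with rfl | hw0
  · simp [hx.not_gt, (mul_pos hb hx).not_gt]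
  · have hset : ∀ a : ℝ, {y : ℝ | a < w * y} = Ioi (a / w) := by
      intro a
      ext y
      simp [div_lt_iff₀' hw0]
    rw [hset, hset, mul_div_assoc]
    refine hbK _ ?_
    rw [le_div_iff₀ hw0, mul_comm]
    exact (mul_le_mul_of_nonneg_right hw.2 hx₀.le).trans hxC

/-- A random sum `∑_{i < N} W_i Y_i` of consistently varying, pairwise quasi-asymptotically
independent, nonnegative terms `Y_i` with bounded nonnegative weights `W_i`. -/
structure IsWeightedSum {Ω : Type*} [MeasurableSpace Ω] (P : Measure Ω) (G : Measure ℝ)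
    (Y W : ℕ → Ω → ℝ) (N : Ω → ℕ) (C : ℝ) : Prop where
  measurable_term : ∀ i, Measurable (Y i)
  measurable_weight : ∀ i, Measurable (W i)
  measurable_count : Measurable N
  law_term : ∀ i, P.map (Y i) = G
  varying : ConsistentlyVarying G
  indep_weight : ∀ i, IndepFun (W i) (Y i) P
  indep_count : IndepFun N (fun ω i => Y i ω) P
  nonneg_term : ∀ᵐ ω ∂P, ∀ i, 0 ≤ Y i ω
  nonneg_weight : ∀ᵐ ω ∂P, ∀ i, 0 ≤ W i ω
  weight_le : ∀ᵐ ω ∂P, ∀ i, W i ω ≤ C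
  weight_eq_zero : ∀ᵐ ω ∂P, ∀ i, N ω ≤ i → W i ω = 0
  bound_pos : 0 < C
  qai : ∀ i j, i ≠ j → ∀ ε : ℝ≥0∞, 0 < ε →
    ∀ᶠ y in atTop, P {ω | y < Y i ω ∧ y < Y j ω} ≤ ε * G (Ioi y)
  moment : ∀ q : ℕ, ∑' n : ℕ, (n : ℝ≥0∞) ^ q * P {ω | N ω = n} ≠ ∞
  tsum_weight_pos : ∑' i, P {ω | 0 < W i ω} ≠ ∞
  exists_weight_pos : ∃ i, P {ω | 0 < W i ω} ≠ 0

namespace IsWeightedSum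

variable {Ω : Type*} [MeasurableSpace Ω] {P : Measure Ω}
  {G : Measure ℝ} {Y W : ℕ → Ω → ℝ} {N : Ω → ℕ} {C : ℝ}

theorem isProbabilityMeasure [IsProbabilityMeasure P] (h : IsWeightedSum P G Y W N C) :
    IsProbabilityMeasure G := by
  rw [← h.law_term 0]
  exact Measure.isProbabilityMeasure_map (h.measurable_term 0).aemeasurable

theorem measure_term (h : IsWeightedSum P G Y W N C) (i : ℕ) (x : ℝ) :
    P {ω | x < Y i ω} = G (Ioi x) := by
  rw [← h.law_term i, Measure.map_apply (h.measurable_term i) measurableSet_Ioi]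
  rfl

/-- Given `N = n`, a sum above `a` has a term above `a / n`; the union bound gives `n * G (Ioi (a /
n))`. Independence of `N` from the whole sequence lets the two factors separate. -/
theorem measure_many_terms_le (h : IsWeightedSum P G Y W N C) (m : ℕ) {a : ℝ} (ha : 0 < a) :
    P {ω | m ≤ N ω ∧ a < ∑ i ∈ Finset.range (N ω), Y i ω} ≤
      ∑' n : ℕ, if m ≤ n then P {ω | N ω = n} * (n * G (Ioi (a / n))) else 0 := by
  have hsub : {ω | m ≤ N ω ∧ a < ∑ i ∈ Finset.range (N ω), Y i ω} ⊆
      ⋃ n : ℕ, {ω | N ω = n ∧ m ≤ n ∧ a < ∑ i ∈ Finset.range n, Y i ω} := by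
    intro ω hω
    exact mem_iUnion.mpr ⟨N ω, rfl, hω⟩
  refine (measure_mono hsub).trans ((measure_iUnion_le _).trans ?_)
  refine ENNReal.tsum_le_tsum fun n => ?_
  split_ifs with hmn
  · have hmeas : MeasurableSet {y : ℕ → ℝ | a < ∑ i ∈ Finset.range n, y i} :=
      measurableSet_lt measurable_const
        (Finset.measurable_fun_sum _ fun i _ => measurable_pi_apply i)
    have hind := h.indep_count.measure_inter_preimage_eq_mul {n}
      {y : ℕ → ℝ | a < ∑ i ∈ Finset.range n, y i} (measurableSet_singleton n) hmeas
    have heq : {ω | N ω = n ∧ m ≤ n ∧ a < ∑ i ∈ Finset.range n, Y i ω} =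
        N ⁻¹' {n} ∩ (fun ω i => Y i ω) ⁻¹' {y : ℕ → ℝ | a < ∑ i ∈ Finset.range n, y i} := by
      ext ω
      simp [hmn]
    rw [heq, hind]
    gcongr ?_ * ?_
    · exact le_rfl
    · have hsub' : (fun ω i => Y i ω) ⁻¹' {y : ℕ → ℝ | a < ∑ i ∈ Finset.range n, y i} ⊆
          ⋃ i ∈ Finset.range n, {ω | a / n < Y i ω} := by
        intro ω hω
        simp only [mem_preimage, mem_ofPred_eq] at hω
        have hn : (0 : ℝ) < n := by
          rcases Nat.eq_zero_or_pos n with rfl | hn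
          · simp at hω; linarith
          · exact_mod_cast hn
        have hlt : ∑ _i ∈ Finset.range n, a / n < ∑ i ∈ Finset.range n, Y i ω := by
          rw [Finset.sum_const, Finset.card_range, nsmul_eq_mul, mul_div_cancel₀ _ hn.ne']
          exact hω
        obtain ⟨i, hi, hi'⟩ := Finset.exists_lt_of_sum_lt hlt
        exact mem_iUnion₂.mpr ⟨i, hi, hi'⟩
      refine (measure_mono hsub').trans ((measure_biUnion_finset_le _ _).trans_eq ?_)
      simp [h.measure_term]
  · simp [hmn]

variable [IsProbabilityMeasure P]

/-- Some weight exceeds some `δ > 0` with positive probability, so `P[W i > δ] * G(x / δ)` is a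
lower bound for one summand, and dominated variation compares `G(x / δ)` with `G(x)`. -/
theorem exists_tail_le_tsum (h : IsWeightedSum P G Y W N C) :
    ∃ M : ℝ≥0∞, M ≠ ∞ ∧
      ∀ x : ℝ, 0 ≤ x → G (Ioi x) ≤ M * ∑' i, P {ω | x < W i ω * Y i ω} := by
  have := h.isProbabilityMeasure
  obtain ⟨i, hi⟩ := h.exists_weight_pos
  have hunion : {ω | 0 < W i ω} = ⋃ n : ℕ, {ω | 1 / ((n : ℝ) + 1) < W i ω} := by
    ext ω
    simp only [mem_ofPred_eq, mem_iUnion]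
    exact ⟨fun h => exists_nat_one_div_lt h, fun ⟨n, hn⟩ => lt_trans Nat.one_div_pos_of_nat hn⟩
  obtain ⟨n, hn⟩ : ∃ n : ℕ, P {ω | 1 / ((n : ℝ) + 1) < W i ω} ≠ 0 := by
    by_contra! hcon
    exact hi (by rw [hunion]; exact measure_iUnion_null hcon)
  have hδ : (0 : ℝ) < 1 / ((n : ℝ) + 1) := Nat.one_div_pos_of_nat
  set δ : ℝ := 1 / ((n : ℝ) + 1) with hδdef
  obtain ⟨M, hM, hle⟩ := h.varying.exists_tail_mul_le_mul hδ
  refine ⟨M * (P {ω | δ < W i ω})⁻¹, ENNReal.mul_ne_top hM (ENNReal.inv_ne_top.mpr hn),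
    fun x hx => ?_⟩
  have hind : P {ω | δ < W i ω} * G (Ioi (x / δ)) ≤ ∑' i, P {ω | x < W i ω * Y i ω} := by
    rw [← h.measure_term i]
    have := (h.indep_weight i).measure_inter_preimage_eq_mul (Ioi δ) (Ioi (x / δ))
      measurableSet_Ioi measurableSet_Ioi
    refine (this.symm.le.trans (measure_mono ?_)).trans
      (ENNReal.le_tsum (f := fun i => P {ω | x < W i ω * Y i ω}) i)
    rintro ω ⟨h1, h2⟩
    simp only [mem_preimage, mem_Ioi] at h1 h2
    rw [div_lt_iff₀ hδ] at h2
    have hY : 0 < Y i ω := by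
      by_contra! hneg
      nlinarith
    simp only [mem_ofPred_eq]
    nlinarith
  have h3 := hle (x / δ) (by positivity)
  rw [mul_div_cancel₀ _ hδ.ne'] at h3
  refine h3.trans ?_
  rw [mul_assoc]
  gcongr
  rwa [← ENNReal.div_eq_inv_mul, ENNReal.le_div_iff_mul_le (Or.inl hn)
    (Or.inl (measure_ne_top _ _)), mul_comm]

theorem eventually_pair_le (h : IsWeightedSum P G Y W N C) {c : ℝ} (hc : 0 < c) {i j : ℕ}
    (hij : i ≠ j) {ε : ℝ≥0∞} (hε : 0 < ε) :
    ∀ᶠ x in atTop, P {ω | c * x < Y i ω ∧ c * x < Y j ω} ≤ ε * G (Ioi x) := by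
  have := h.isProbabilityMeasure
  obtain ⟨M, hM, hle⟩ := h.varying.exists_tail_mul_le_mul hc
  -- `M + 1` serves as a divisor that is certainly nonzero.
  have hM1 : M + 1 ≠ ∞ := ENNReal.add_ne_top.mpr ⟨hM, ENNReal.one_ne_top⟩
  have hev := (tendsto_id.const_mul_atTop hc).eventually
    (h.qai i j hij (ε / (M + 1)) (ENNReal.div_pos hε.ne' hM1))
  filter_upwards [hev, eventually_ge_atTop 0] with x hx hx0
  refine hx.trans ?_
  calc ε / (M + 1) * G (Ioi (c * x)) ≤ ε / (M + 1) * ((M + 1) * G (Ioi x)) := by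
        gcongr
        exact (hle x hx0).trans (by gcongr; exact le_self_add)
    _ = ε * G (Ioi x) := by
        rw [← mul_assoc, ENNReal.div_mul_cancel (by simp) hM1]

/-- The Potter bound turns `n * G(c * x / n)` into a constant times `n ^ (p + 1) * G(x)`, so the
tail of the series for the moment of order `p + 1` of `N` gives an `m` that works for all `x > 0` at
once. -/
theorem exists_many_terms_le (h : IsWeightedSum P G Y W N C) {c : ℝ} (hc : 0 < c) {ε : ℝ≥0∞}
    (hε : 0 < ε) :
    ∃ m : ℕ, ∀ x : ℝ, 0 < x →
      P {ω | m ≤ N ω ∧ c * x < ∑ i ∈ Finset.range (N ω), Y i ω} ≤ ε * G (Ioi x) := by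
  have := h.isProbabilityMeasure
  obtain ⟨M₁, hM₁, h₁⟩ := h.varying.exists_tail_mul_le_mul hc
  obtain ⟨M₂, hM₂, p, h₂⟩ := h.varying.exists_tail_div_nat_le
  set M := M₂ * M₁ + 1 with hMdef
  have hM : M ≠ ∞ := ENNReal.add_ne_top.mpr ⟨ENNReal.mul_ne_top hM₂ hM₁, ENNReal.one_ne_top⟩
  have hM0 : M ≠ 0 := by simp [hMdef]
  obtain ⟨m, hm⟩ := exists_tsum_tail_le (h.moment (p + 1)) (ENNReal.div_pos hε.ne' hM)
  refine ⟨m, fun x hx => (h.measure_many_terms_le m (mul_pos hc hx)).trans ?_⟩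
  calc ∑' n : ℕ, (if m ≤ n then P {ω | N ω = n} * (n * G (Ioi (c * x / n))) else 0)
      ≤ ∑' n : ℕ, M * G (Ioi x) *
          (if m ≤ n then (n : ℝ≥0∞) ^ (p + 1) * P {ω | N ω = n} else 0) := by
        refine ENNReal.tsum_le_tsum fun n => ?_
        split_ifs with hmn
        · rcases Nat.eq_zero_or_pos n with rfl | hn
          · simp
          · calc P {ω | N ω = n} * (n * G (Ioi (c * x / n)))
                ≤ P {ω | N ω = n} * (n * (M₂ * (n : ℝ≥0∞) ^ p * (M₁ * G (Ioi x)))) := by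
                  gcongr
                  exact (h₂ _ (by positivity) n hn).trans (by gcongr; exact h₁ x hx.le)
              _ = M₂ * M₁ * G (Ioi x) * ((n : ℝ≥0∞) ^ (p + 1) * P {ω | N ω = n}) := by ring
              _ ≤ M * G (Ioi x) * ((n : ℝ≥0∞) ^ (p + 1) * P {ω | N ω = n}) := by
                  gcongr
                  exact le_self_add
        · simp
    _ = M * G (Ioi x) * ∑' n : ℕ, (if m ≤ n then (n : ℝ≥0∞) ^ (p + 1) * P {ω | N ω = n} else 0) :=
        ENNReal.tsum_mul_left
    _ ≤ M * G (Ioi x) * (ε / M) := by gcongr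
    _ = ε / M * M * G (Ioi x) := by ring
    _ = ε * G (Ioi x) := by rw [ENNReal.div_mul_cancel hM0 hM]

theorem eventually_sum_pairs_le (h : IsWeightedSum P G Y W N C) {c : ℝ} (hc : 0 < c) (m : ℕ)
    {ε : ℝ≥0∞} (hε : 0 < ε) :
    ∀ᶠ x in atTop, ∑ i ∈ Finset.range m, ∑ j ∈ Finset.range m,
      (if i ≠ j then P {ω | c * x < Y i ω ∧ c * x < Y j ω} else 0) ≤ ε * G (Ioi x) := by
  set δ : ℝ≥0∞ := ε / (m * m + 1) with hδdef
  have hm : (m * m + 1 : ℝ≥0∞) ≠ ∞ := by exact_mod_cast ENNReal.natCast_ne_top (m * m + 1)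
  have hδ : 0 < δ := ENNReal.div_pos hε.ne' hm
  have hev : ∀ᶠ x in atTop, ∀ i ∈ Finset.range m, ∀ j ∈ Finset.range m,
      (if i ≠ j then P {ω | c * x < Y i ω ∧ c * x < Y j ω} else 0) ≤ δ * G (Ioi x) := by
    simp only [Finset.eventually_all]
    intro i _ j _
    by_cases hij : i = j
    · simp [hij]
    · simpa [hij] using h.eventually_pair_le hc hij hδ
  filter_upwards [hev] with x hx
  calc _ ≤ ∑ i ∈ Finset.range m, ∑ j ∈ Finset.range m, δ * G (Ioi x) :=
        Finset.sum_le_sum fun i hi => Finset.sum_le_sum fun j hj => hx i hi j hj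
    _ = (m * m) * (δ * G (Ioi x)) := by simp [mul_assoc]
    _ ≤ (m * m + 1) * (δ * G (Ioi x)) := by gcongr; exact le_self_add
    _ = δ * (m * m + 1) * G (Ioi x) := by ring
    _ = ε * G (Ioi x) := by rw [hδdef, ENNReal.div_mul_cancel (by simp) hm]

/-- The event is covered by `E₁` (at least `m` terms), `E₂` (one weighted term above `b * x`) and
`E₃` (two large terms). `E₂` yields the main term; `E₁` and `E₃` each cost `ε * G(x)`. -/
theorem eventually_sum_le_add (h : IsWeightedSum P G Y W N C) {ε : ℝ≥0∞} (hε : 0 < ε)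
    (hε' : ε ≠ ∞) :
    ∀ᶠ x in atTop, P {ω | x < ∑ i ∈ Finset.range (N ω), W i ω * Y i ω} ≤
      (1 + ε) * ∑' i, P {ω | x < W i ω * Y i ω} + 2 * ε * G (Ioi x) := by
  have := h.isProbabilityMeasure
  have hC := h.bound_pos
  obtain ⟨b, hb0, hb1, x₀, hx₀, hb⟩ := h.varying.exists_tail_mul_le hε
  obtain ⟨m, hm⟩ := h.exists_many_terms_le (inv_pos.mpr hC) hε
  -- `(1 - b) / m` is the pair threshold of the one-big-jump lemma and `C⁻¹` strips the weights; `m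
  -- + 1` keeps the constant meaningful for `m = 0`.
  have hc : 0 < C⁻¹ * (1 - b) / (m + 1) := by
    have : 0 < 1 - b := by linarith
    positivity
  filter_upwards [h.eventually_sum_pairs_le hc m hε, eventually_gt_atTop 0,
    eventually_ge_atTop (C * x₀)] with x hpair hx hxC
  set c := C⁻¹ * (1 - b) / (m + 1) with hcdef
  set E₁ := {ω | m ≤ N ω ∧ C⁻¹ * x < ∑ i ∈ Finset.range (N ω), Y i ω} with hE₁
  set E₂ := ⋃ i ∈ Finset.range m, {ω | b * x < W i ω * Y i ω} with hE₂
  set E₃ := ⋃ i ∈ Finset.range m, ⋃ j ∈ Finset.range m,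
    {ω | i ≠ j ∧ c * x < Y i ω ∧ c * x < Y j ω} with hE₃
  have hsub : ({ω | x < ∑ i ∈ Finset.range (N ω), W i ω * Y i ω} : Set Ω) ≤ᵐ[P]
      (E₁ ∪ (E₂ ∪ E₃) : Set Ω) := by
    filter_upwards [h.nonneg_term, h.nonneg_weight, h.weight_le, h.weight_eq_zero]
      with ω hY hW hWC hW0 hω
    have hω' : x < ∑ i ∈ Finset.range (N ω), W i ω * Y i ω := hω
    rcases le_or_gt m (N ω) with hmN | hmN
    · refine Or.inl ⟨hmN, ?_⟩
      rw [inv_mul_lt_iff₀ hC, Finset.mul_sum]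
      exact hω'.trans_le (Finset.sum_le_sum fun i _ => mul_le_mul_of_nonneg_right (hWC i) (hY i))
    -- Weights vanish from index `N` on, so the random range may be padded to the deterministic
    -- length `m`.
    · have hsum : ∑ i ∈ Finset.range (N ω), W i ω * Y i ω =
          ∑ i ∈ Finset.range m, W i ω * Y i ω := by
        refine Finset.sum_subset (Finset.range_mono hmN.le) fun i _ hi => ?_
        rw [hW0 i (by simpa using hi), zero_mul]
      rw [hsum] at hω'
      have hcx : ∀ i, (1 - b) * x / m < W i ω * Y i ω → c * x < Y i ω := by
        intro i hi
        have h1 : (1 - b) * x / (m + 1) < W i ω * Y i ω := by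
          refine lt_of_le_of_lt ?_ hi
          have h0 : 0 ≤ (1 - b) * x := mul_nonneg (by linarith) hx.le
          have hm0 : (0 : ℝ) < m := by exact_mod_cast (Nat.zero_le _).trans_lt hmN
          gcongr
          linarith
        have h2 := inv_mul_lt_of_lt_mul hC (hY i) (hWC i) h1
        calc c * x = C⁻¹ * ((1 - b) * x / (m + 1)) := by rw [hcdef]; ring
          _ < Y i ω := h2
      rcases exists_lt_or_exists_pair_lt_of_lt_sum hb0 hb1.le hx hω' with
        ⟨i, hi, hlt⟩ | ⟨i, hi, j, hj, hij, h1, h2⟩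
      · exact Or.inr (Or.inl (mem_iUnion₂.mpr ⟨i, hi, hlt⟩))
      · exact Or.inr (Or.inr (mem_iUnion₂.mpr ⟨i, hi, mem_iUnion₂.mpr
          ⟨j, hj, hij, hcx i h1, hcx j h2⟩⟩))
  have h₂ : P E₂ ≤ (1 + ε) * ∑' i, P {ω | x < W i ω * Y i ω} := by
    refine (measure_biUnion_finset_le _ _).trans ((ENNReal.sum_le_tsum _).trans ?_)
    rw [← ENNReal.tsum_mul_left]
    refine ENNReal.tsum_le_tsum fun i => ?_
    refine measure_mul_lt_mul_le (h.measurable_weight i) (h.measurable_term i) (h.indep_weight i)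
      (C := C) ?_ hb0 hx₀ (ENNReal.add_ne_top.mpr ⟨ENNReal.one_ne_top, hε'⟩) ?_ hx hxC
    · filter_upwards [h.nonneg_weight, h.weight_le] with ω h1 h2 using ⟨h1 i, h2 i⟩
    · rw [h.law_term i]
      exact hb
  have h₃ : P E₃ ≤ ε * G (Ioi x) := by
    refine (measure_biUnion_finset_le _ _).trans (le_trans ?_ hpair)
    refine Finset.sum_le_sum fun i _ => (measure_biUnion_finset_le _ _).trans ?_
    refine Finset.sum_le_sum fun j _ => ?_
    by_cases hij : i = j <;> simp [hij]
  calc _ ≤ P (E₁ ∪ (E₂ ∪ E₃)) := measure_mono_ae hsub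
    _ ≤ P E₁ + (P E₂ + P E₃) := (measure_union_le _ _).trans (by gcongr; exact measure_union_le _ _)
    _ ≤ ε * G (Ioi x) + ((1 + ε) * ∑' i, P {ω | x < W i ω * Y i ω} + ε * G (Ioi x)) := by
        gcongr
        exact hm x hx
    _ = _ := by ring

/-- For indices below `m`, Bonferroni leaves pair probabilities, which bounded weights reduce to
pairs of `Y`. For `i ≥ m`, independence bounds the summand by `P[W i > 0] * G(x / C)`, and `∑ P[W i
> 0]` converges. -/
theorem eventually_tsum_le_add (h : IsWeightedSum P G Y W N C) {ε : ℝ≥0∞} (hε : 0 < ε) :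
    ∀ᶠ x in atTop, ∑' i, P {ω | x < W i ω * Y i ω} ≤
      P {ω | ∃ i, x < W i ω * Y i ω} + 2 * ε * G (Ioi x) := by
  have := h.isProbabilityMeasure
  have hC := h.bound_pos
  obtain ⟨M, hM, hle⟩ := h.varying.exists_tail_mul_le_mul (inv_pos.mpr hC)
  have hM1 : M + 1 ≠ ∞ := ENNReal.add_ne_top.mpr ⟨hM, ENNReal.one_ne_top⟩
  obtain ⟨m, hm⟩ := exists_tsum_tail_le h.tsum_weight_pos (ENNReal.div_pos hε.ne' hM1)
  filter_upwards [h.eventually_sum_pairs_le (inv_pos.mpr hC) m hε, eventually_gt_atTop 0]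
    with x hpair hx
  have hmeas : ∀ i, MeasurableSet {ω | x < W i ω * Y i ω} := fun i =>
    measurableSet_lt measurable_const ((h.measurable_weight i).mul (h.measurable_term i))
  have hsplit : ∑' i, P {ω | x < W i ω * Y i ω} =
      ∑ i ∈ Finset.range m, P {ω | x < W i ω * Y i ω} +
        ∑' i, (if m ≤ i then P {ω | x < W i ω * Y i ω} else 0) := by
    have h1 : ∑ i ∈ Finset.range m, P {ω | x < W i ω * Y i ω} =
        ∑' i, (if m ≤ i then 0 else P {ω | x < W i ω * Y i ω}) := by
      rw [tsum_eq_sum (s := Finset.range m)]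
      · refine Finset.sum_congr rfl fun i hi => ?_
        rw [if_neg (not_le.mpr (Finset.mem_range.mp hi))]
      · intro i hi
        rw [if_pos (by simpa using hi)]
    rw [h1, ← ENNReal.tsum_add]
    refine tsum_congr fun i => ?_
    split_ifs <;> simp
  have hfst : ∑ i ∈ Finset.range m, P {ω | x < W i ω * Y i ω} ≤
      P {ω | ∃ i, x < W i ω * Y i ω} + ε * G (Ioi x) := by
    refine (sum_measure_le_measure_biUnion_add P hmeas m).trans (add_le_add ?_ (le_trans ?_ hpair))
    · refine measure_mono (iUnion₂_subset fun i _ ω hω => ⟨i, hω⟩)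
    · refine Finset.sum_le_sum fun i hi => ?_
      have hsub : Finset.range i ⊆ Finset.range m :=
        Finset.range_mono (Finset.mem_range.mp hi).le
      refine le_trans (Finset.sum_le_sum fun j hj => ?_)
        (Finset.sum_le_sum_of_subset (f := fun j =>
          if i ≠ j then P {ω | C⁻¹ * x < Y i ω ∧ C⁻¹ * x < Y j ω} else 0) hsub)
      have hij : i ≠ j := (Finset.mem_range.mp hj).ne'
      simp only [hij, ne_eq, not_false_eq_true, if_true]
      refine measure_mono_ae ?_
      filter_upwards [h.nonneg_term, h.weight_le] with ω hY hWC hω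
      exact ⟨inv_mul_lt_of_lt_mul hC (hY i) (hWC i) hω.2,
        inv_mul_lt_of_lt_mul hC (hY j) (hWC j) hω.1⟩
  have hsnd : ∑' i, (if m ≤ i then P {ω | x < W i ω * Y i ω} else 0) ≤ ε * G (Ioi x) := by
    calc _ ≤ ∑' i, (M + 1) * G (Ioi x) * (if m ≤ i then P {ω | 0 < W i ω} else 0) := by
          refine ENNReal.tsum_le_tsum fun i => ?_
          split_ifs with hi
          · have hind := (h.indep_weight i).measure_inter_preimage_eq_mul (Ioi 0)
              (Ioi (C⁻¹ * x)) measurableSet_Ioi measurableSet_Ioi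
            have hsub : ({ω | x < W i ω * Y i ω} : Set Ω) ≤ᵐ[P]
                (W i ⁻¹' Ioi 0 ∩ Y i ⁻¹' Ioi (C⁻¹ * x) : Set Ω) := by
              filter_upwards [h.nonneg_term, h.weight_le] with ω hY hWC hω
              have hω' : x < W i ω * Y i ω := hω
              exact ⟨pos_of_mul_pos_left (hx.trans hω') (hY i),
                inv_mul_lt_of_lt_mul hC (hY i) (hWC i) hω⟩
            refine (measure_mono_ae hsub).trans (hind.le.trans ?_)
            rw [mul_comm]
            gcongr ?_ * ?_
            · exact ((h.measure_term i _).le.trans (hle x hx.le)).trans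
                (by gcongr; exact le_self_add)
            · exact le_rfl
          · simp
      _ = (M + 1) * G (Ioi x) * ∑' i, (if m ≤ i then P {ω | 0 < W i ω} else 0) :=
          ENNReal.tsum_mul_left
      _ ≤ (M + 1) * G (Ioi x) * (ε / (M + 1)) := by gcongr
      _ = ε / (M + 1) * (M + 1) * G (Ioi x) := by ring
      _ = ε * G (Ioi x) := by rw [ENNReal.div_mul_cancel (by simp) hM1]
  rw [hsplit]
  refine (add_le_add hfst hsnd).trans_eq ?_
  ring

/-- A family of events squeezed between `max W_i Y_i > x` and `∑ W_i Y_i > x` has probability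
asymptotically equal to `∑ P[W_i Y_i > x]`. -/
theorem tendsto_div (h : IsWeightedSum P G Y W N C) {B : ℝ → Set Ω}
    (hlower : ∀ x, 0 < x → ({ω | ∃ i, x < W i ω * Y i ω} : Set Ω) ≤ᵐ[P] B x)
    (hupper : ∀ x, 0 < x →
      B x ≤ᵐ[P] ({ω | x < ∑ i ∈ Finset.range (N ω), W i ω * Y i ω} : Set Ω)) :
    Tendsto (fun x => P.real (B x) / (∑' i, P {ω | x < W i ω * Y i ω}).toReal) atTop (𝓝 1) := by
  have := h.isProbabilityMeasure
  obtain ⟨M, hM, hle⟩ := h.exists_tail_le_tsum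
  have hfin : ∀ x, 0 < x → ∑' i, P {ω | x < W i ω * Y i ω} ≠ ∞ := by
    intro x hx
    refine ne_top_of_le_ne_top h.tsum_weight_pos (ENNReal.tsum_le_tsum fun i => ?_)
    refine measure_mono_ae ?_
    filter_upwards [h.nonneg_term] with ω hY hω
    exact pos_of_mul_pos_left (hx.trans hω) (hY i)
  rw [Metric.tendsto_nhds]
  intro δ hδ
  have hM2 : 1 + 2 * M ≠ ∞ :=
    ENNReal.add_ne_top.mpr ⟨ENNReal.one_ne_top, ENNReal.mul_ne_top (by simp) hM⟩
  -- Both bounds have relative error at most `ε + 2 * ε * M` once `G(x) ≤ M * H(x)` is inserted;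
  -- this choice makes it `δ / 2`.
  set ε : ℝ≥0∞ := ENNReal.ofReal (δ / 2) / (1 + 2 * M) with hεdef
  have hε0 : 0 < ε := ENNReal.div_pos (by simpa using hδ) hM2
  have hε1 : ε ≠ ∞ := ENNReal.div_ne_top ENNReal.ofReal_ne_top (by simp)
  have hεM : ε + 2 * ε * M = ENNReal.ofReal (δ / 2) := by
    calc ε + 2 * ε * M = ε * (1 + 2 * M) := by ring
      _ = _ := ENNReal.div_mul_cancel (by simp) hM2
  filter_upwards [h.eventually_sum_le_add hε0 hε1, h.eventually_tsum_le_add hε0,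
    eventually_gt_atTop 0] with x h1 h2 hx
  set H := ∑' i, P {ω | x < W i ω * Y i ω} with hH
  have hHfin := hfin x hx
  have hG := hle x hx.le
  have hHpos : H ≠ 0 := by
    intro h0
    rw [← hH, h0, mul_zero] at hG
    exact (h.varying.1 x).not_ge hG
  have hrem : 2 * ε * G (Ioi x) ≤ 2 * ε * M * H := by
    rw [mul_assoc (2 * ε) M H]
    gcongr
  have hup : P (B x) ≤ H + ENNReal.ofReal (δ / 2) * H := by
    calc P (B x) ≤ _ := measure_mono_ae (hupper x hx)
      _ ≤ (1 + ε) * H + 2 * ε * M * H := h1.trans (by gcongr)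
      _ = H + (ε + 2 * ε * M) * H := by ring
      _ = _ := by rw [hεM]
  have hlo : H ≤ P (B x) + ENNReal.ofReal (δ / 2) * H := by
    calc H ≤ P {ω | ∃ i, x < W i ω * Y i ω} + 2 * ε * M * H := h2.trans (by gcongr)
      _ ≤ P (B x) + (ε + 2 * ε * M) * H :=
          add_le_add (measure_mono_ae (hlower x hx)) (by gcongr; exact le_add_self)
      _ = _ := by rw [hεM]
  have hupR : P.real (B x) ≤ H.toReal + δ / 2 * H.toReal := by
    have := ENNReal.toReal_mono (by finiteness) hup
    rwa [ENNReal.toReal_add hHfin (by finiteness), ENNReal.toReal_mul,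
      ENNReal.toReal_ofReal (by positivity)] at this
  have hloR : H.toReal ≤ P.real (B x) + δ / 2 * H.toReal := by
    have := ENNReal.toReal_mono (by finiteness) hlo
    rwa [ENNReal.toReal_add (by finiteness) (by finiteness), ENNReal.toReal_mul,
      ENNReal.toReal_ofReal (by positivity)] at this
  have hHR : 0 < H.toReal := ENNReal.toReal_pos hHpos hHfin
  rw [Real.dist_eq, div_sub_one hHR.ne', abs_div, abs_of_pos hHR, div_lt_iff₀ hHR, abs_lt]
  constructor <;> nlinarith

end IsWeightedSum

/-! ### The scaling functional of a rare set -/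

section ScaleSup

variable {d : ℕ} {A : Set (Fin d → ℝ)}

theorem scaleSup_zero (hA : IsRareSet A) : scaleSup A 0 = 0 := by
  refine le_antisymm ?_ (scaleSup_nonneg hA le_rfl)
  by_contra! hpos
  have h := (lt_scaleSup_iff hA le_rfl (half_pos hpos)).mp (half_lt_self hpos)
  rw [mem_smul_set_iff_inv_smul_mem₀ (half_pos hpos).ne', smul_zero] at h
  exact hA.zero_notMem_closure (subset_closure h)

/-- Convexity of `Aᶜ`: if `y / u` and `z / v` lie in `Aᶜ`, so does their convex combination `(y + z)
/ (u + v)` with weights `u / (u + v)` and `v / (u + v)`. -/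
theorem scaleSup_add_le (hA : IsRareSet A) {y z : Fin d → ℝ} (hy : 0 ≤ y) (hz : 0 ≤ z) :
    scaleSup A (y + z) ≤ scaleSup A y + scaleSup A z := by
  by_contra! hlt
  -- A third of the gap: raising both levels by `δ` still leaves `u + v` below `scaleSup A (y + z)`.
  set δ := (scaleSup A (y + z) - (scaleSup A y + scaleSup A z)) / 3 with hδ
  have hδ0 : 0 < δ := by rw [hδ]; linarith
  set u := scaleSup A y + δ with hu
  set v := scaleSup A z + δ with hv
  have hu0 : 0 < u := by linarith [scaleSup_nonneg hA hy]
  have hv0 : 0 < v := by linarith [scaleSup_nonneg hA hz]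
  have hyu : u⁻¹ • y ∈ Aᶜ := by
    rw [mem_compl_iff, ← mem_smul_set_iff_inv_smul_mem₀ hu0.ne', ← lt_scaleSup_iff hA hy hu0]
    linarith
  have hzv : v⁻¹ • z ∈ Aᶜ := by
    rw [mem_compl_iff, ← mem_smul_set_iff_inv_smul_mem₀ hv0.ne', ← lt_scaleSup_iff hA hz hv0]
    linarith
  have huv : u + v < scaleSup A (y + z) := by
    rw [hu, hv]; linarith
  have huv0 : 0 < u + v := add_pos hu0 hv0
  rw [lt_scaleSup_iff hA (add_nonneg hy hz) huv0,
    mem_smul_set_iff_inv_smul_mem₀ huv0.ne'] at huv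
  have hconv := hA.convex_compl hyu hzv (a := u / (u + v)) (b := v / (u + v)) (by positivity)
    (by positivity) (by field_simp)
  refine hconv ?_
  convert huv using 1
  rw [smul_smul, smul_smul, smul_add]
  congr 2 <;> field_simp

theorem smul_mem_smul_iff_lt (hA : IsRareSet A) {z : Fin d → ℝ} (hz : 0 ≤ z) {w x : ℝ}
    (hw : 0 < w) (hx : 0 < x) : w • z ∈ x • A ↔ x < w * scaleSup A z := by
  rw [← div_lt_iff₀' hw, lt_scaleSup_iff hA hz (div_pos hx hw),
    mem_smul_set_iff_inv_smul_mem₀ hx.ne', mem_smul_set_iff_inv_smul_mem₀ (div_pos hx hw).ne',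
    smul_smul, inv_div, div_eq_inv_mul]

theorem scaleSup_smul_le (hA : IsRareSet A) {z : Fin d → ℝ} (hz : 0 ≤ z) {w : ℝ} (hw : 0 < w) :
    scaleSup A (w • z) ≤ w * scaleSup A z := by
  by_contra! hlt
  obtain ⟨x, h1, h2⟩ := exists_between hlt
  have hx : 0 < x := (mul_nonneg hw.le (scaleSup_nonneg hA hz)).trans_lt h1
  exact h1.not_gt ((smul_mem_smul_iff_lt hA hz hw hx).mp
    ((lt_scaleSup_iff hA (smul_nonneg hw.le hz) hx).mp h2))

theorem scaleSup_sum_le (hA : IsRareSet A) {z : ℕ → Fin d → ℝ} (hz : ∀ i, 0 ≤ z i) {w : ℕ → ℝ}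
    (hw : ∀ i, 0 < w i) (n : ℕ) :
    scaleSup A (∑ i ∈ Finset.range n, w i • z i) ≤ ∑ i ∈ Finset.range n, w i * scaleSup A (z i) := by
  induction n with
  | zero => simp [scaleSup_zero hA]
  | succ n ih =>
    rw [Finset.sum_range_succ, Finset.sum_range_succ]
    exact (scaleSup_add_le hA (Finset.sum_nonneg fun i _ => smul_nonneg (hw i).le (hz i))
      (smul_nonneg (hw n).le (hz n))).trans (add_le_add ih (scaleSup_smul_le hA (hz n) (hw n)))

theorem mem_smul_of_le (hA : IsRareSet A) {y z : Fin d → ℝ} (hyz : y ≤ z) {x : ℝ} (hx : 0 < x)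
    (hy : y ∈ x • A) : z ∈ x • A := by
  rw [mem_smul_set_iff_inv_smul_mem₀ hx.ne'] at hy ⊢
  exact hA.increasing (smul_le_smul_of_nonneg_left hyz (inv_pos.mpr hx).le) hy

end ScaleSup

/-! ### The renewal counting process -/

theorem tsum_pow_mul_ne_top_of_le_geometric {a r : ℝ} (hr0 : 0 ≤ r) (hr1 : r < 1)
    {f : ℕ → ℝ≥0∞} (hle : ∀ n, f n ≤ ENNReal.ofReal (a * r ^ n)) (q : ℕ) :
    ∑' n : ℕ, (n : ℝ≥0∞) ^ q * f n ≠ ∞ := by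
  have hgeom : Summable fun n : ℕ => (n : ℝ) ^ q * r ^ n :=
    summable_pow_mul_geometric_of_norm_lt_one (R := ℝ) q
      (by rwa [Real.norm_eq_abs, abs_of_nonneg hr0])
  have hsum : Summable fun n : ℕ => a * ((n : ℝ) ^ q * r ^ n) := Summable.mul_left a hgeom
  refine ne_top_of_le_ne_top hsum.tsum_ofReal_ne_top (ENNReal.tsum_le_tsum fun n => ?_)
  have hpow : ENNReal.ofReal ((n : ℝ) ^ q) = (n : ℝ≥0∞) ^ q := by
    rw [ENNReal.ofReal_pow (Nat.cast_nonneg n), ENNReal.ofReal_natCast]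
  calc (n : ℝ≥0∞) ^ q * f n
      ≤ ENNReal.ofReal ((n : ℝ) ^ q) * ENNReal.ofReal (a * r ^ n) := by
        rw [hpow]
        exact mul_le_mul_right (hle n) _
    _ = ENNReal.ofReal (a * ((n : ℝ) ^ q * r ^ n)) := by
        rw [← ENNReal.ofReal_mul (by positivity)]
        congr 1
        ring

section Counting

variable {Ω : Type*} (θ : ℕ → Ω → ℝ≥0)

theorem natCast_succ_le_countingProcess_iff (t : ℝ≥0) (ω : Ω) (i : ℕ) :
    ((i + 1 : ℕ) : ℕ∞) ≤ countingProcess θ t ω ↔ arrivalTime θ i ω ≤ t := by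
  refine ⟨fun h => ?_, fun h => le_iSup₂_of_le i h le_rfl⟩
  by_contra hlt
  have hle : countingProcess θ t ω ≤ (i : ℕ∞) := by
    refine iSup₂_le fun j hj => ?_
    have : j < i := by
      by_contra hji
      exact hlt ((arrivalTime_mono θ ω (not_lt.mp hji)).trans hj)
    exact_mod_cast this
  have := h.trans hle
  norm_cast at this
  omega

/-- Finiteness matters because `ENat.toNat` sends `⊤` to 0. -/
theorem lt_toNat_countingProcess_iff {t : ℝ≥0} {ω : Ω} (h : countingProcess θ t ω ≠ ⊤) (i : ℕ) :
    i < (countingProcess θ t ω).toNat ↔ arrivalTime θ i ω ≤ t := by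
  rw [← natCast_succ_le_countingProcess_iff]
  obtain ⟨n, hn⟩ := ENat.ne_top_iff_exists.mp h
  rw [← hn, ENat.toNat_natCast]
  norm_cast

/-- Arrival times are recovered from the counting process. The model states independence for `N`,
and this transfers it to the `τ_i`. -/
theorem measurable_arrivalTime_of_comap (i : ℕ) :
    Measurable[MeasurableSpace.comap (fun ω t => countingProcess θ t ω) MeasurableSpace.pi]
      (arrivalTime θ i) := by
  refine @measurable_of_Iic _ _ _ _ _ (_) _ _ _ _ fun t => ?_
  refine ⟨{N | ((i + 1 : ℕ) : ℕ∞) ≤ N t}, ?_, ?_⟩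
  · exact (measurable_pi_apply (X := fun _ : ℝ≥0 => ℕ∞) t)
      (to_countable (Ici ((i + 1 : ℕ) : ℕ∞))).measurableSet
  · ext ω
    exact natCast_succ_le_countingProcess_iff θ t ω i

theorem measurable_of_measurableSet_natCast_le [MeasurableSpace Ω] {f : Ω → ℕ∞}
    (hf : ∀ k : ℕ, MeasurableSet {ω | (k : ℕ∞) ≤ f ω}) : Measurable f := by
  refine measurable_to_countable' fun x => ?_
  induction x with
  | top =>
    have : f ⁻¹' {⊤} = ⋂ k : ℕ, {ω | (k : ℕ∞) ≤ f ω} := by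
      ext ω
      simp only [mem_preimage, mem_singleton_iff, mem_iInter, mem_ofPred_eq]
      exact ENat.eq_top_iff_forall_ge
    rw [this]
    exact MeasurableSet.iInter hf
  | coe n =>
    have : f ⁻¹' {(n : ℕ∞)} = {ω | (n : ℕ∞) ≤ f ω} \ {ω | ((n + 1 : ℕ) : ℕ∞) ≤ f ω} := by
      ext ω
      simp only [mem_preimage, mem_singleton_iff, Set.mem_sdiff, mem_ofPred_eq]
      rcases eq_or_ne (f ω) ⊤ with h | h
      · simp [h]
      · obtain ⟨m, hm⟩ := ENat.ne_top_iff_exists.mp h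
        rw [← hm]
        norm_cast
        omega
    rw [this]
    exact (hf n).diff (hf (n + 1))

variable {θ} [MeasurableSpace Ω]

theorem measurable_arrivalTime (hθ : ∀ i, Measurable (θ i)) (i : ℕ) :
    Measurable (arrivalTime θ i) :=
  Finset.measurable_fun_sum _ fun j _ => hθ j

theorem measurable_countingProcess (hθ : ∀ i, Measurable (θ i)) (t : ℝ≥0) :
    Measurable (countingProcess θ t) := by
  refine measurable_of_measurableSet_natCast_le fun k => ?_
  rcases k with _ | k
  · simp
  · simp only [natCast_succ_le_countingProcess_iff]
    exact measurableSet_le (measurable_arrivalTime hθ k) measurable_const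

variable {P : Measure Ω}

theorem ae_countingProcess_ne_top (hθ : ∀ i, Measurable (θ i)) {T : ℝ≥0}
    (hfin : renewalFunction P θ T < ∞) : ∀ᵐ ω ∂P, countingProcess θ T ω ≠ ⊤ := by
  have hmeas : Measurable fun ω => (countingProcess θ T ω : ℝ≥0∞) :=
    (measurable_of_countable ((↑) : ℕ∞ → ℝ≥0∞)).comp (measurable_countingProcess hθ T)
  filter_upwards [ae_lt_top hmeas hfin.ne] with ω hω h
  simp [h] at hω

theorem tsum_measure_arrivalTime_le (hθ : ∀ i, Measurable (θ i)) (T : ℝ≥0) :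
    ∑' i, P {ω | arrivalTime θ i ω ≤ T} = renewalFunction P θ T := by
  rw [← renewalMeasure_Iic P θ hθ, renewalMeasure, Measure.sum_apply _ measurableSet_Iic]
  refine tsum_congr fun i => ?_
  rw [Measure.map_apply (measurable_arrivalTime hθ i) measurableSet_Iic]
  rfl

variable [IsProbabilityMeasure P]

/-- If `E[e^{-θ}] = 1` then `θ = 0` almost surely, all arrivals occur at time 0 and `λ(0) = ∞`. -/
theorem mgf_interarrival_lt_one (hθ : ∀ i, Measurable (θ i))
    (hident : ∀ i, IdentDistrib (θ i) (θ 0) P P) (hfin : renewalFunction P θ 0 < ∞) :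
    mgf (fun ω => (θ 0 ω : ℝ)) P (-1) < 1 := by
  by_contra! hge
  have hmeas : Measurable fun ω => Real.exp (-1 * (θ 0 ω : ℝ)) :=
    ((measurable_coe_nnreal_real.comp (hθ 0)).const_mul _).exp
  have hle : ∀ ω, Real.exp (-1 * (θ 0 ω : ℝ)) ≤ 1 := fun ω => by
    rw [Real.exp_le_one_iff]; linarith [(θ 0 ω).coe_nonneg]
  have hint : Integrable (fun ω => Real.exp (-1 * (θ 0 ω : ℝ))) P :=
    Integrable.of_bound hmeas.aestronglyMeasurable 1 (ae_of_all _ fun ω => by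
      rw [Real.norm_eq_abs, abs_of_pos (Real.exp_pos _)]; exact hle ω)
  have hzero : ∫ ω, (1 - Real.exp (-1 * (θ 0 ω : ℝ))) ∂P = 0 := by
    refine le_antisymm ?_ (integral_nonneg fun ω => sub_nonneg.mpr (hle ω))
    rw [integral_sub (integrable_const _) hint]
    simpa [mgf] using hge
  have hae := (integral_eq_zero_iff_of_nonneg (fun ω => sub_nonneg.mpr (hle ω))
    ((integrable_const 1).sub hint)).mp hzero
  have h0 : ∀ᵐ ω ∂P, θ 0 ω = 0 := by
    filter_upwards [hae] with ω hω
    have h1 : Real.exp (-1 * (θ 0 ω : ℝ)) = 1 := by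
      have : 1 - Real.exp (-1 * (θ 0 ω : ℝ)) = 0 := hω
      linarith
    have h2 := (Real.exp_eq_one_iff _).mp h1
    exact NNReal.coe_eq_zero.mp (by linarith)
  have hall : ∀ᵐ ω ∂P, ∀ i, θ i ω = 0 := ae_all_iff.mpr fun i =>
    (hident i).symm.ae_snd (measurableSet_singleton 0) h0
  have hone : ∀ i, P.map (arrivalTime θ i) (Iic 0) = 1 := by
    intro i
    rw [Measure.map_apply (measurable_arrivalTime hθ i) measurableSet_Iic]
    refine (measure_congr (eventuallyEq_univ.mpr ?_)).trans measure_univ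
    filter_upwards [hall] with ω hω
    simp [arrivalTime, hω]
  rw [← renewalMeasure_Iic P θ hθ, renewalMeasure, Measure.sum_apply _ measurableSet_Iic] at hfin
  simp only [hone] at hfin
  rw [ENNReal.tsum_const_eq_top_of_ne_zero one_ne_zero] at hfin
  exact hfin.ne rfl

/-- Chernoff's bound at parameter `-1`; the exponent is `i + 1` because `arrivalTime θ i` has `i +
1` summands. -/
theorem measure_arrivalTime_le (hθ : ∀ i, Measurable (θ i)) (hind : iIndepFun θ P)
    (hident : ∀ i, IdentDistrib (θ i) (θ 0) P P) (T : ℝ≥0) (i : ℕ) :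
    P {ω | arrivalTime θ i ω ≤ T} ≤
      ENNReal.ofReal (Real.exp T * mgf (fun ω => (θ 0 ω : ℝ)) P (-1) ^ (i + 1)) := by
  have hθ' : ∀ j, Measurable fun ω => (θ j ω : ℝ) := fun j =>
    measurable_coe_nnreal_real.comp (hθ j)
  have hind' : iIndepFun (fun j ω => (θ j ω : ℝ)) P :=
    hind.comp (fun _ => ((↑) : ℝ≥0 → ℝ)) fun _ => measurable_coe_nnreal_real
  have hmgf := hind'.mgf_sum hθ' (t := -1) (Finset.range (i + 1))
  have hcongr : ∀ j, mgf (fun ω => (θ j ω : ℝ)) P (-1) = mgf (fun ω => (θ 0 ω : ℝ)) P (-1) :=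
    fun j => congrFun (mgf_congr_identDistrib ((hident j).comp measurable_coe_nnreal_real)) _
  rw [Finset.prod_congr rfl fun j _ => hcongr j, Finset.prod_const, Finset.card_range] at hmgf
  set S : Ω → ℝ := ∑ j ∈ Finset.range (i + 1), fun ω => (θ j ω : ℝ) with hS
  have hSτ : ∀ ω, S ω = arrivalTime θ i ω := fun ω => by
    simp [hS, arrivalTime]
  have hSm : Measurable S := by
    rw [funext hSτ]
    exact measurable_coe_nnreal_real.comp (measurable_arrivalTime hθ i)
  have hint : Integrable (fun ω => Real.exp (-1 * S ω)) P :=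
    Integrable.of_bound (hSm.const_mul _).exp.aestronglyMeasurable 1 (ae_of_all _ fun ω => by
      rw [Real.norm_eq_abs, abs_of_pos (Real.exp_pos _), Real.exp_le_one_iff, hSτ]
      linarith [(arrivalTime θ i ω).coe_nonneg])
  have h := measure_le_le_exp_mul_mgf (X := S) (μ := P) (T : ℝ) (by norm_num) hint
  rw [hmgf, neg_neg, one_mul] at h
  have hset : {ω | arrivalTime θ i ω ≤ T} = {ω | S ω ≤ T} := by
    ext ω
    simp [hSτ]
  rw [hset, ← ofReal_measureReal]
  exact ENNReal.ofReal_le_ofReal h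

theorem measure_countingProcess_eq_le (hθ : ∀ i, Measurable (θ i))
    (hind : iIndepFun θ P) (hident : ∀ i, IdentDistrib (θ i) (θ 0) P P) (T : ℝ≥0) (n : ℕ) :
    P {ω | (countingProcess θ T ω).toNat = n} ≤
      ENNReal.ofReal (Real.exp T * mgf (fun ω => (θ 0 ω : ℝ)) P (-1) ^ n) := by
  rcases n with _ | n
  -- The case `n = 0` also contains the event `N = ⊤`; here the trivial bound by 1 suffices.
  · refine prob_le_one.trans ?_
    rw [pow_zero, mul_one, ENNReal.one_le_ofReal]
    exact Real.one_le_exp T.coe_nonneg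
  · refine (measure_mono fun ω hω => ?_).trans (measure_arrivalTime_le hθ hind hident T n)
    have hω' : (countingProcess θ T ω).toNat = n + 1 := hω
    have hne : countingProcess θ T ω ≠ ⊤ := by
      intro h
      simp [h] at hω'
    have hlt : n < (countingProcess θ T ω).toNat := by omega
    exact (lt_toNat_countingProcess_iff θ hne n).mp hlt

theorem tsum_pow_mul_measure_countingProcess_ne_top (hθ : ∀ i, Measurable (θ i))
    (hind : iIndepFun θ P) (hident : ∀ i, IdentDistrib (θ i) (θ 0) P P)
    (hfin : renewalFunction P θ 0 < ∞) (T : ℝ≥0) (q : ℕ) :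
    ∑' n : ℕ, (n : ℝ≥0∞) ^ q * P {ω | (countingProcess θ T ω).toNat = n} ≠ ∞ :=
  tsum_pow_mul_ne_top_of_le_geometric mgf_nonneg (mgf_interarrival_lt_one hθ hident hfin)
    (measure_countingProcess_eq_le hθ hind hident T) q

end Counting

/-! ### Measurability and independence in the risk model -/

section Measurability

variable {Ω : Type*} [MeasurableSpace Ω] {d : ℕ} {ξ : ℝ≥0 → Ω → ℝ}

/-- The discount factor of the claim arriving at time `τ`, set to `0` after the horizon `T`. -/
noncomputable def discountWeight {Ω : Type*} (ξ : ℝ≥0 → Ω → ℝ) (T : ℝ≥0) (τ : Ω → ℝ≥0)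
    (ω : Ω) : ℝ :=
  if τ ω ≤ T then Real.exp (-ξ (τ ω) ω) else 0

theorem measurable_discountWeight (hξ : Measurable fun p : ℝ≥0 × Ω => ξ p.1 p.2) (T : ℝ≥0)
    {τ : Ω → ℝ≥0} (hτ : Measurable τ) : Measurable (discountWeight ξ T τ) :=
  Measurable.ite (measurableSet_le hτ measurable_const)
    (hξ.comp (hτ.prodMk measurable_id)).neg.exp measurable_const

theorem measurableSet_discounted_claim_mem (hξ : Measurable fun p : ℝ≥0 × Ω => ξ p.1 p.2)
    (T : ℝ≥0) {Z : Ω → Fin d → ℝ} (hZ : Measurable Z) {B : Set (Fin d → ℝ)} (hB : IsOpen B) :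
    MeasurableSet {p : ℝ≥0 × Ω | p.1 ≤ T ∧ Real.exp (-ξ p.1 p.2) • Z p.2 ∈ B} :=
  (measurableSet_le measurable_fst measurable_const).inter
    ((hξ.neg.exp.smul (hZ.comp measurable_snd)) hB.measurableSet)

theorem measure_mem_eq_lintegral_of_indepFun {P : Measure Ω} [IsProbabilityMeasure P]
    {α β : Type*} [MeasurableSpace α] [MeasurableSpace β] {f : Ω → α} {g : Ω → β}
    (hf : Measurable f) (hg : Measurable g) (hfg : IndepFun f g P) {S : Set (α × β)}
    (hS : MeasurableSet S) :
    P {ω | (f ω, g ω) ∈ S} = ∫⁻ a, P {ω | (a, g ω) ∈ S} ∂(P.map f) := by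
  have h := (indepFun_iff_map_prod_eq_prod_map_map hf.aemeasurable hg.aemeasurable).mp hfg
  have := Measure.isProbabilityMeasure_map (μ := P) hg.aemeasurable
  calc P {ω | (f ω, g ω) ∈ S} = P.map (fun ω => (f ω, g ω)) S := by
        rw [Measure.map_apply (hf.prodMk hg) hS]; rfl
    _ = ∫⁻ a, P {ω | (a, g ω) ∈ S} ∂(P.map f) := by
        rw [h, Measure.prod_apply hS]
        refine lintegral_congr fun a => ?_
        rw [Measure.map_apply hg (measurable_prodMk_left hS)]
        rfl

theorem measurable_process_apply (hξ : Measurable fun p : ℝ≥0 × Ω => ξ p.1 p.2) (s : ℝ≥0) :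
    Measurable (ξ s) :=
  hξ.comp measurable_prodMk_left

end Measurability

/-- Fubini for the pair of `f` and the identity map into `(Ω, m)`. It allows a random time `f` to be
frozen inside a process that is jointly measurable with respect to an independent `m`. -/
theorem measure_mem_eq_lintegral_of_indep {Ω α : Type*} {m : MeasurableSpace Ω}
    [mα : MeasurableSpace α] [mΩ : MeasurableSpace Ω] {P : Measure Ω} [IsProbabilityMeasure P]
    (hm : m ≤ mΩ) {f : Ω → α} (hf : Measurable f)
    (hind : Indep (MeasurableSpace.comap f mα) m P) {S : Set (α × Ω)}
    (hS : MeasurableSet[mα.prod m] S) :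
    P {ω | (f ω, ω) ∈ S} = ∫⁻ a, P {ω | (a, ω) ∈ S} ∂(P.map f) := by
  have hfid : @IndepFun Ω α Ω mΩ mα m f id P := by
    refine (@IndepFun_iff_Indep Ω α Ω mΩ mα m f id P).mpr ?_
    rwa [MeasurableSpace.comap_id]
  exact @measure_mem_eq_lintegral_of_indepFun Ω mΩ P _ α Ω mα m f id hf (measurable_id'' hm)
    hfid S hS

section Independence

variable {Ω : Type*} {d : ℕ} {X : ℕ → Ω → Fin d → ℝ}

theorem measurable_claim_of_comap (i : ℕ) :
    Measurable[MeasurableSpace.comap (fun ω i => X i ω) MeasurableSpace.pi] (X i) :=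
  fun s hs => ⟨(fun x => x i) ⁻¹' s, measurable_pi_apply i hs, rfl⟩

variable [mΩ : MeasurableSpace Ω] {P : Measure Ω}
  {F : Measure (Fin d → ℝ)} {θ : ℕ → Ω → ℝ≥0} {ξ : ℝ≥0 → Ω → ℝ}

theorem IsRenewalRiskModel.comap_claim_le (h : IsRenewalRiskModel P F X θ ξ) :
    MeasurableSpace.comap (fun ω i => X i ω) MeasurableSpace.pi ≤ mΩ :=
  (measurable_pi_lambda _ h.measurable_claim).comap_le

theorem IsRenewalRiskModel.comap_count_le (h : IsRenewalRiskModel P F X θ ξ) :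
    MeasurableSpace.comap (fun ω t => countingProcess θ t ω) MeasurableSpace.pi ≤ mΩ :=
  (measurable_pi_lambda _ (measurable_countingProcess h.measurable_interarrival)).comap_le

/-- Two groupings are needed: `(N, ξ)` against `X` makes the weights independent of the claims, and
`N` against `(X, ξ)` permits conditioning on an arrival time. -/
theorem IsRenewalRiskModel.exists_indep (h : IsRenewalRiskModel P F X θ ξ) :
    ∃ 𝒢 : MeasurableSpace Ω, 𝒢 ≤ mΩ ∧
      Measurable[(inferInstance : MeasurableSpace ℝ≥0).prod 𝒢] (fun p : ℝ≥0 × Ω => ξ p.1 p.2) ∧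
      Indep (MeasurableSpace.comap (fun ω t => countingProcess θ t ω) MeasurableSpace.pi ⊔ 𝒢)
        (MeasurableSpace.comap (fun ω i => X i ω) MeasurableSpace.pi) P ∧
      Indep (MeasurableSpace.comap (fun ω t => countingProcess θ t ω) MeasurableSpace.pi)
        (MeasurableSpace.comap (fun ω i => X i ω) MeasurableSpace.pi ⊔ 𝒢) P := by
  have hXle := h.comap_claim_le
  have hNle := h.comap_count_le
  obtain ⟨𝒢, h𝒢, hξ, hind⟩ := h.mutuallyIndependent
  refine ⟨𝒢, h𝒢, hξ, ?_, ?_⟩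
  · have := indep_iSup_of_disjoint (S := {1, 2}) (T := {0}) ?_ hind (by simp)
    · simpa [iSup_pair] using this
    · intro i
      fin_cases i <;> simpa
  · have := indep_iSup_of_disjoint (S := {1}) (T := {0, 2}) ?_ hind (by simp)
    · simpa [iSup_pair] using this
    · intro i
      fin_cases i <;> simpa

theorem IsRenewalRiskModel.measurable_process (h : IsRenewalRiskModel P F X θ ξ) :
    Measurable fun p : ℝ≥0 × Ω => ξ p.1 p.2 := by
  obtain ⟨𝒢, h𝒢, hξ, -⟩ := h.exists_indep
  exact hξ.mono (sup_le_sup le_rfl (MeasurableSpace.comap_mono h𝒢)) le_rfl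

theorem IsRenewalRiskModel.indepFun_weight (h : IsRenewalRiskModel P F X θ ξ) (T : ℝ≥0) (i : ℕ) :
    IndepFun (discountWeight ξ T (arrivalTime θ i)) (fun ω i => X i ω) P := by
  obtain ⟨𝒢, h𝒢, hξ, hind, -⟩ := h.exists_indep
  rw [IndepFun_iff_Indep]
  refine indep_of_indep_of_le_left hind (Measurable.comap_le ?_)
  refine @measurable_discountWeight Ω (_) ξ
    (hξ.mono (sup_le_sup le_rfl (MeasurableSpace.comap_mono le_sup_right)) le_rfl) T _ ?_
  exact (measurable_arrivalTime_of_comap θ i).mono le_sup_left le_rfl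

theorem IsRenewalRiskModel.indepFun_count (h : IsRenewalRiskModel P F X θ ξ) (T : ℝ≥0) :
    IndepFun (fun ω => (countingProcess θ T ω).toNat) (fun ω i => X i ω) P := by
  have htoNat : Measurable (ENat.toNat : ℕ∞ → ℕ) := measurable_of_countable _
  have heval : Measurable fun N : ℝ≥0 → ℕ∞ => (N T).toNat :=
    htoNat.comp (measurable_pi_apply (X := fun _ : ℝ≥0 => ℕ∞) T)
  obtain ⟨𝒢, h𝒢, hξ, hind, -⟩ := h.exists_indep
  rw [IndepFun_iff_Indep]
  refine indep_of_indep_of_le_left hind (le_trans (Measurable.comap_le ?_) le_sup_left)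
  exact fun s hs => ⟨(fun N : ℝ≥0 → ℕ∞ => (N T).toNat) ⁻¹' s, heval hs, rfl⟩

theorem IsRenewalRiskModel.indepFun_process (h : IsRenewalRiskModel P F X θ ξ) (s : ℝ≥0) (i : ℕ) :
    IndepFun (ξ s) (X i) P := by
  obtain ⟨𝒢, h𝒢, hξ, hind, -⟩ := h.exists_indep
  rw [IndepFun_iff_Indep]
  refine indep_of_indep_of_le_left (indep_of_indep_of_le_right hind
    (measurable_claim_of_comap i).comap_le) (le_trans (Measurable.comap_le ?_) le_sup_right)
  exact @measurable_process_apply Ω 𝒢 ξ hξ s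

variable [IsProbabilityMeasure P]

theorem IsRenewalRiskModel.measure_discounted_claim_eq (h : IsRenewalRiskModel P F X θ ξ)
    (s : ℝ≥0) (i : ℕ) {B : Set (Fin d → ℝ)} (hB : IsOpen B) :
    P {ω | Real.exp (-ξ s ω) • X i ω ∈ B} = P {ω | Real.exp (-ξ s ω) • X 0 ω ∈ B} := by
  have hs : Measurable (ξ s) := h.measurable_process.comp measurable_prodMk_left
  have hS : MeasurableSet {p : ℝ × (Fin d → ℝ) | Real.exp (-p.1) • p.2 ∈ B} :=
    (measurable_fst.neg.exp.smul measurable_snd) hB.measurableSet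
  have key : ∀ j, P {ω | Real.exp (-ξ s ω) • X j ω ∈ B} =
      ((P.map (ξ s)).prod F) {p : ℝ × (Fin d → ℝ) | Real.exp (-p.1) • p.2 ∈ B} := by
    intro j
    rw [← h.law_claim j, ← (indepFun_iff_map_prod_eq_prod_map_map hs.aemeasurable
      (h.measurable_claim j).aemeasurable).mp (h.indepFun_process s j),
      Measure.map_apply (hs.prodMk (h.measurable_claim j)) hS]
    rfl
  rw [key, key]

/-- Freeze `τ_i = s`: the remaining randomness lives on `σ(X) ⊔ 𝒢`, independent of `τ_i`. Then `X i`
may be replaced by `X 0`, as both have law `F` and are independent of `ξ s`. -/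
theorem IsRenewalRiskModel.measure_claim_at_arrival (h : IsRenewalRiskModel P F X θ ξ)
    (T : ℝ≥0) (i : ℕ) {B : Set (Fin d → ℝ)} (hB : IsOpen B) :
    P {ω | arrivalTime θ i ω ≤ T ∧ Real.exp (-ξ (arrivalTime θ i ω) ω) • X i ω ∈ B} =
      ∫⁻ s in Iic T, P {ω | Real.exp (-ξ s ω) • X 0 ω ∈ B} ∂(P.map (arrivalTime θ i)) := by
  have hXle := h.comap_claim_le
  have hτ := measurable_arrivalTime h.measurable_interarrival i
  have hcongr := fun s => h.measure_discounted_claim_eq s i hB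
  obtain ⟨𝒢, h𝒢, hξ, -, hind⟩ := h.exists_indep
  have hS := @measurableSet_discounted_claim_mem Ω
    (MeasurableSpace.comap (fun ω i => X i ω) MeasurableSpace.pi ⊔ 𝒢) d ξ
    (hξ.mono (sup_le_sup le_rfl (MeasurableSpace.comap_mono le_sup_right)) le_rfl) T (X i)
    ((measurable_claim_of_comap i).mono le_sup_left le_rfl) B hB
  have key := @measure_mem_eq_lintegral_of_indep Ω ℝ≥0 _ _ mΩ P _ (sup_le hXle h𝒢)
    (arrivalTime θ i) hτ
    (indep_of_indep_of_le_left hind (measurable_arrivalTime_of_comap θ i).comap_le) _ hS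
  refine key.trans ?_
  rw [← lintegral_indicator measurableSet_Iic]
  refine lintegral_congr fun s => ?_
  by_cases hs : s ≤ T
  · simp [hs, hcongr]
  · simp [hs]

/-- The renewal measure is the sum of the laws of the arrival times, so the previous identity is
summed over `i`. -/
theorem IsRenewalRiskModel.integral_claim_eq_toReal_tsum (h : IsRenewalRiskModel P F X θ ξ)
    (T : ℝ≥0) {B : Set (Fin d → ℝ)} (hB : IsOpen B) :
    ∫ s in Iic T, P.real {ω | Real.exp (-ξ s ω) • X 0 ω ∈ B} ∂(renewalMeasure P θ) =
      (∑' i, P {ω | arrivalTime θ i ω ≤ T ∧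
        Real.exp (-ξ (arrivalTime θ i ω) ω) • X i ω ∈ B}).toReal := by
  have hS : MeasurableSet {p : ℝ≥0 × Ω | Real.exp (-ξ p.1 p.2) • X 0 p.2 ∈ B} :=
    (h.measurable_process.neg.exp.smul ((h.measurable_claim 0).comp measurable_snd))
      hB.measurableSet
  have hmeas : Measurable fun s => P {ω | Real.exp (-ξ s ω) • X 0 ω ∈ B} :=
    measurable_measure_prodMk_left hS
  simp only [measureReal_def]
  rw [integral_toReal hmeas.aemeasurable (ae_of_all _ fun s => measure_lt_top _ _), renewalMeasure,
    Measure.restrict_sum_of_countable, lintegral_sum_measure]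
  simp only [h.measure_claim_at_arrival T _ hB]

end Independence

/-! ### The aggregate claims as a weighted random sum -/

section Aggregate

variable {Ω : Type*} [MeasurableSpace Ω] {P : Measure Ω} {d : ℕ}
  {F : Measure (Fin d → ℝ)} {X : ℕ → Ω → Fin d → ℝ} {θ : ℕ → Ω → ℝ≥0} {ξ : ℝ≥0 → Ω → ℝ}
  {A : Set (Fin d → ℝ)}

theorem IsRenewalRiskModel.ae_claim (h : IsRenewalRiskModel P F X θ ξ)
    {p : (Fin d → ℝ) → Prop} (hp : ∀ᵐ z ∂F, p z) : ∀ᵐ ω ∂P, ∀ i, p (X i ω) := by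
  refine ae_all_iff.mpr fun i => ?_
  rw [← h.law_claim i] at hp
  exact ae_of_ae_map (h.measurable_claim i).aemeasurable hp

variable [IsProbabilityMeasure P]

theorem eventually_measure_pair_le_of_tendsto {G : Measure ℝ} (hG : ∀ x, 0 < G (Ioi x))
    {Y Z : Ω → ℝ} (hY : ∀ x, P {ω | x < Y ω} = G (Ioi x)) (hZ : ∀ x, P {ω | x < Z ω} = G (Ioi x))
    (hlim : Tendsto (fun x : ℝ => P.real {ω | x < Y ω ∧ x < Z ω} /
      (P.real {ω | x < Y ω} + P.real {ω | x < Z ω})) atTop (𝓝 0))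
    {ε : ℝ≥0∞} (hε : 0 < ε) :
    ∀ᶠ x in atTop, P {ω | x < Y ω ∧ x < Z ω} ≤ ε * G (Ioi x) := by
  -- Half of `ε`, because the denominator is twice the common tail.
  obtain ⟨r, hr0, hr⟩ := ENNReal.lt_iff_exists_nnreal_btwn.mp (ENNReal.half_pos hε.ne')
  have hr0' : 0 < r := by exact_mod_cast hr0
  filter_upwards [hlim.eventually_lt_const (show (0 : ℝ) < r from hr0')] with x hx
  have hreal : P.real {ω | x < Y ω} = (G (Ioi x)).toReal := by rw [measureReal_def, hY]
  have hreal' : P.real {ω | x < Z ω} = (G (Ioi x)).toReal := by rw [measureReal_def, hZ]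
  have hfin : G (Ioi x) ≠ ∞ := hY x ▸ measure_ne_top _ _
  have hpos : 0 < (G (Ioi x)).toReal := ENNReal.toReal_pos (hG x).ne' hfin
  rw [hreal, hreal', div_lt_iff₀ (by positivity)] at hx
  calc P {ω | x < Y ω ∧ x < Z ω} = ENNReal.ofReal (P.real {ω | x < Y ω ∧ x < Z ω}) := by simp
    _ ≤ ENNReal.ofReal (r * ((G (Ioi x)).toReal + (G (Ioi x)).toReal)) :=
        ENNReal.ofReal_le_ofReal hx.le
    _ = (r + r) * G (Ioi x) := by
        rw [ENNReal.ofReal_mul r.coe_nonneg, ENNReal.ofReal_add hpos.le hpos.le,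
          ENNReal.ofReal_toReal hfin, ENNReal.ofReal_coe_nnreal]
        ring
    _ ≤ ε * G (Ioi x) := by
        gcongr
        calc (r + r : ℝ≥0∞) ≤ ε / 2 + ε / 2 := add_le_add hr.le hr.le
          _ = ε := ENNReal.add_halves ε

/-- `scaleSup A` is known to be measurable only up to `F`-null sets, so the terms use a measurable
version `g`. The weight bound `e^K` comes from `ξ ≥ -K` on `[0, T]`. -/
theorem IsRenewalRiskModel.isWeightedSum (h : IsRenewalRiskModel P F X θ ξ)
    (hX : QAIOn P A X) (hF : ConsistentlyVaryingOn A F)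
    {T : ℝ≥0} (hT : 0 < renewalFunction P θ T) {K : ℝ} (hK : ∀ᵐ ω ∂P, ∀ t ≤ T, -K ≤ ξ t ω)
    {g : (Fin d → ℝ) → ℝ} (hg : Measurable g) (hgA : scaleSup A =ᵐ[F] g) (hg0 : ∀ᵐ z ∂F, 0 ≤ g z) :
    IsWeightedSum P (F.map g) (fun i ω => g (X i ω))
      (fun i => discountWeight ξ T (arrivalTime θ i))
      (fun ω => (countingProcess θ T ω).toNat) (Real.exp K) := by
  have hτ := measurable_arrivalTime h.measurable_interarrival
  have hpos : ∀ i, {ω | 0 < discountWeight ξ T (arrivalTime θ i) ω} =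
      {ω | arrivalTime θ i ω ≤ T} := by
    intro i
    ext ω
    by_cases hω : arrivalTime θ i ω ≤ T <;> simp [discountWeight, hω, Real.exp_pos]
  have hlaw : ∀ i, P.map (fun ω => g (X i ω)) = F.map g := fun i => by
    rw [← h.law_claim i, Measure.map_map hg (h.measurable_claim i)]
    rfl
  have hvar : ConsistentlyVarying (F.map g) := by
    rw [← Measure.map_congr hgA]
    exact hF
  have hgX : Measurable fun (x : ℕ → Fin d → ℝ) i => g (x i) :=
    measurable_pi_lambda _ fun i => hg.comp (measurable_pi_apply i)
  have hsum : ∑' i, P {ω | 0 < discountWeight ξ T (arrivalTime θ i) ω} = renewalFunction P θ T := by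
    simp only [hpos]
    exact tsum_measure_arrivalTime_le h.measurable_interarrival T
  refine
    { measurable_term := fun i => hg.comp (h.measurable_claim i)
      measurable_weight := fun i => measurable_discountWeight h.measurable_process T (hτ i)
      measurable_count := (measurable_of_countable ENat.toNat).comp
        (measurable_countingProcess h.measurable_interarrival T)
      law_term := hlaw
      varying := hvar
      indep_weight := fun i => (h.indepFun_weight T i).comp measurable_id
        (hg.comp (measurable_pi_apply i))
      indep_count := (h.indepFun_count T).comp measurable_id hgX
      nonneg_term := h.ae_claim hg0
      nonneg_weight := ae_of_all _ fun ω i => ?_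
      weight_le := ?_
      weight_eq_zero := ?_
      bound_pos := Real.exp_pos K
      qai := ?_
      moment := tsum_pow_mul_measure_countingProcess_ne_top h.measurable_interarrival
        h.iIndepFun_interarrival h.identDistrib_interarrival (h.renewalFunction_lt_top 0) T
      tsum_weight_pos := hsum ▸ (h.renewalFunction_lt_top T).ne
      exists_weight_pos := ?_ }
  · unfold discountWeight
    split_ifs <;> positivity
  · filter_upwards [hK] with ω hω i
    unfold discountWeight
    split_ifs with hi
    · exact Real.exp_le_exp.mpr (by linarith [hω _ hi])
    · positivity
  · filter_upwards [ae_countingProcess_ne_top h.measurable_interarrival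
      (h.renewalFunction_lt_top T)] with ω hω i hi
    exact if_neg fun hle => hi.not_gt ((lt_toNat_countingProcess_iff θ hω i).mpr hle)
  · intro i j hij ε hε
    have hae := h.ae_claim hgA
    have htail : ∀ i x, P {ω | x < g (X i ω)} = F.map g (Ioi x) := fun i x => by
      rw [← hlaw i, Measure.map_apply (f := fun ω => g (X i ω)) (hg.comp (h.measurable_claim i))
        measurableSet_Ioi]
      rfl
    have hsingle : ∀ i (x : ℝ), P.real {ω | x < g (X i ω)} = P.real {ω | x < scaleSup A (X i ω)} :=
      fun i x => measureReal_congr (by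
        filter_upwards [hae] with ω hω
        exact congrArg (x < ·) (hω i).symm)
    have hpair : ∀ x : ℝ, P.real {ω | x < g (X i ω) ∧ x < g (X j ω)} =
        P.real {ω | x < scaleSup A (X i ω) ∧ x < scaleSup A (X j ω)} :=
      fun x => measureReal_congr (by
        filter_upwards [hae] with ω hω
        exact congrArg₂ (fun a b => x < a ∧ x < b) (hω i).symm (hω j).symm)
    refine eventually_measure_pair_le_of_tendsto hvar.1 (htail i) (htail j) ?_ hε
    simp only [hsingle, hpair]
    exact hX i j hij
  · by_contra! hzero
    rw [← hsum] at hT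
    simp [hzero] at hT

theorem tendsto_measure_aggregateClaims_div (h : IsRenewalRiskModel P F X θ ξ)
    (hξ : BoundedAwayFromNegInfty P θ ξ) (hA : IsRareSet A) (hX : QAIOn P A X)
    (hF : ConsistentlyVaryingOn A F) (T : ℝ≥0) (hT : 0 < renewalFunction P θ T) :
    Tendsto
      (fun x : ℝ => P.real {ω | aggregateClaims X θ ξ T ω ∈ x • A} /
        ∫ s in Iic T, P.real {ω | Real.exp (-ξ s ω) • X 0 ω ∈ x • A} ∂(renewalMeasure P θ))
      atTop (𝓝 1) := by
  obtain ⟨K, -, hK⟩ := hξ T hT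
  have hmeas := aemeasurable_scaleSup hA h.nonneg_claim
  obtain ⟨g, hg, hgA⟩ := hmeas
  have hg0 : ∀ᵐ z ∂F, 0 ≤ g z := by
    filter_upwards [hgA, h.nonneg_claim] with z hz hz0
    exact hz ▸ scaleSup_nonneg hA hz0
  have hsum := h.isWeightedSum hX hF hT hK hg hgA hg0
  have hgood : ∀ᵐ ω ∂P, countingProcess θ T ω ≠ ⊤ ∧ ∀ i, scaleSup A (X i ω) = g (X i ω) ∧
      0 ≤ X i ω := by
    filter_upwards [ae_countingProcess_ne_top h.measurable_interarrival
      (h.renewalFunction_lt_top T), h.ae_claim (hgA.and h.nonneg_claim)] with ω h1 h2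
    exact ⟨h1, h2⟩
  -- After the horizon the weight is 0 and `x > 0`, so both sides fail.
  have hiff : ∀ x, 0 < x → ∀ᵐ ω ∂P, ∀ i, x < discountWeight ξ T (arrivalTime θ i) ω * g (X i ω) ↔
      arrivalTime θ i ω ≤ T ∧ Real.exp (-ξ (arrivalTime θ i ω) ω) • X i ω ∈ x • A := by
    intro x hx
    filter_upwards [hgood] with ω hω i
    rw [smul_mem_smul_iff_lt hA (hω.2 i).2 (Real.exp_pos _) hx, (hω.2 i).1]
    by_cases hi : arrivalTime θ i ω ≤ T
    · simp [discountWeight, hi]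
    · simp [discountWeight, hi, hx.le]
  have hden : ∀ x : ℝ, 0 < x →
      ∫ s in Iic T, P.real {ω | Real.exp (-ξ s ω) • X 0 ω ∈ x • A} ∂(renewalMeasure P θ) =
      (∑' i, P {ω | x < discountWeight ξ T (arrivalTime θ i) ω * g (X i ω)}).toReal := by
    intro x hx
    rw [h.integral_claim_eq_toReal_tsum T (hA.isOpen.smul₀ hx.ne')]
    congr 1
    refine tsum_congr fun i => measure_congr ?_
    filter_upwards [hiff x hx] with ω hω
    exact propext (hω i).symm
  refine (hsum.tendsto_div (B := fun x => {ω | aggregateClaims X θ ξ T ω ∈ x • A}) ?_ ?_).congr' ?_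
  · intro x hx
    filter_upwards [hgood, hiff x hx] with ω hω hωx hmem
    obtain ⟨i, hi⟩ := hmem
    obtain ⟨hiT, hi'⟩ := (hωx i).mp hi
    -- `D(T)` dominates each of its nonnegative summands componentwise, and `A` is increasing.
    refine mem_smul_of_le hA ?_ hx hi'
    exact Finset.single_le_sum
      (f := fun i => Real.exp (-ξ (arrivalTime θ i ω) ω) • X i ω)
      (fun j _ => smul_nonneg (Real.exp_pos _).le (hω.2 j).2)
      (Finset.mem_range.mpr ((lt_toNat_countingProcess_iff θ hω.1 i).mpr hiT))
  · intro x hx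
    filter_upwards [hgood] with ω hω hmem
    have hnonneg : 0 ≤ aggregateClaims X θ ξ T ω :=
      Finset.sum_nonneg fun j _ => smul_nonneg (Real.exp_pos _).le (hω.2 j).2
    have hlt := (lt_scaleSup_iff hA hnonneg hx).mpr hmem
    -- Subadditivity of `scaleSup A` passes from the vector sum to the scalar sum; every index below
    -- `N(T)` has arrived by `T`, so its weight is the true discount factor.
    refine (hlt.trans_le (scaleSup_sum_le hA (z := fun i => X i ω) (fun i => (hω.2 i).2)
      (fun i => Real.exp_pos _) _)).trans_eq (Finset.sum_congr rfl fun i hi => ?_)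
    have hiT := (lt_toNat_countingProcess_iff θ hω.1 i).mp (Finset.mem_range.mp hi)
    simp only [discountWeight, if_pos hiT, (hω.2 i).1]
  · filter_upwards [eventually_gt_atTop 0] with x hx
    rw [hden x hx]

end Aggregate

end RiskModel

theorem theorem3p2 {Ω : Type*} [MeasurableSpace Ω] (P : Measure Ω) [IsProbabilityMeasure P]
    {d : ℕ} (F : Measure (Fin d → ℝ)) (X : ℕ → Ω → Fin d → ℝ) (θ : ℕ → Ω → ℝ≥0)
    (ξ : ℝ≥0 → Ω → ℝ)
    (hmodel : RiskModel.IsRenewalRiskModel P F X θ ξ)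
    (hξ : RiskModel.BoundedAwayFromNegInfty P θ ξ)
    (A : Set (Fin d → ℝ)) (hA : RiskModel.IsRareSet A)
    (hX : RiskModel.QAIOn P A X)
    (hF : RiskModel.ConsistentlyVaryingOn A F)
    (T : ℝ≥0) (hT : 0 < RiskModel.renewalFunction P θ T) :
    Tendsto
      (fun x : ℝ =>
        P.real {ω | RiskModel.aggregateClaims X θ ξ T ω ∈ x • A} /
          ∫ s in Set.Iic T, P.real {ω | Real.exp (-ξ s ω) • X 0 ω ∈ x • A}
            ∂(RiskModel.renewalMeasure P θ))
      atTop (𝓝 1) :=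
  RiskModel.tendsto_measure_aggregateClaims_div hmodel hξ hA hX hF T hT
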